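/- A space of quasi-polynomials is a complex vector space $V$ spanned by functions $p_{ij}(x)e^{\lambda_i x}$, $i=1,\dots,n$, $j=1,\dots,N_i$ ($n,N_i\ge 1$), with distinct $\lambda_i\in\mathbb C$ and polynomials satisfying $0<\deg p_{i1}<\dots<\deg p_{iN_i}$; put $N=\sum_i N_i=\dim V$. Let $\bar D_V$ be its monic fundamental operator, i.e. the unique monic linear differential operator of order $N$ annihilating $V$ (its coefficients are quotients of Wronskian determinants). Let $z_1,\dots,z_m$ be the singular points of $V$, i.e. the points where the set of orders of vanishing of the nonzero elements of $V$ is not $\{0,\dots,N-1\}$, and let $M_a$ be the smallest natural number such that $(x-z_a)^{M_a}\bar D_V$ has no poles at $z_a$. Let $V^\dagger$ be the span of the functions $\prod_a (x-z_a)^{-M_a}\,\mathrm{Wr}(f_1,\dots,f_{N-1})/\mathrm{Wr}_V$, $f_i\in V$, where $\mathrm{Wr}$ denotes the Wronskian and $\mathrm{Wr}_V$ the Wronskian of a basis of $V$. The space $U$ spanned by the functions $u\mapsto\int_{\gamma_a}e^{ux}f(x)\,dx$, with $f\in V^\dagger$, $a=1,\dots,m$, and $\gamma_a$ a small counterclockwise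 circle around $z_a$, is called bispectral dual to $V$. A subspace $W\subset\mathbb C[t]$ is called admissible, $W\in\mathrm{Gr}$, if $W=\bigcap_i W_{\lambda_i}$ for finitely many distinct points $\lambda_i\in\mathbb C$ and subspaces $W_{\lambda_i}\subset\mathbb C[t]$ such that $(t-\lambda_i)^k\,\mathbb C[t]\subset W_{\lambda_i}$ for some $k\ge0$ and some $f\in W_{\lambda_i}$ has $f(\lambda_i)\ne0$. To a space of quasi-polynomials $V$ as above, with $p_{ij}=\sum_{b\ge 0}c_{ijb}x^b$, there corresponds the subspace $$W=\Big\{r\in\mathbb C[t]\ :\ \sum_{b\ge0}c_{ijb}\,r^{(b)}(\lambda_i)=0\ \text{ for all } i,j\Big\},$$ which in turn determines $V$ as the span of all the functions $p(x)e^{\lambda x}$, $p=\sum_b c_bx^b$, $\lambda\in\mathbb C$, such that $\sum_b c_b r^{(b)}(\lambda)=0$ for all $r\in W$. The stationary Baker–Akhiezer function of $W$ is $$\Psi_W(x,\xi)=\prod_{i=1}^n(\xi-\lambda_i)^{-N_i}\ \bar D_V\,e^{x\xi}.$$ **Theorem.** Let $V$ and $U$ be spaces of quasi-polynomials such that $U$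 is bispectral dual to $V$, and let $W$ and $Y$ be the subspaces of $\mathbb C[t]$ corresponding to $V$ and $U$. Then $W$ and $Y$ are admissible, and they are bispectral dual with respect to their Baker–Akhiezer functions: $$\Psi_Y(x,\xi)=\Psi_W(\xi,x)$$ as meromorphic functions of $(x,\xi)$ (that is, at all points where both sides are defined). -/

import Mathlib

namespace Bispectral

open Polynomial

noncomputable section

/-! ### Spaces of functions and their fundamental operators -/

/-- The determinant of the matrix whose `a`-th row consists of the derivatives of `f a` of
orders `d 0, d 1, …`, evaluated at `x`. -/
def genWronskian {k : ℕ} (f : Fin k → ℂ → ℂ) (d : Fin k → ℕ) (x : ℂ) : ℂ :=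
  (Matrix.of fun a b : Fin k => iteratedDeriv (d b) (f a) x).det

/-- The Wronskian `Wr(f₁, …, f_k)`. -/
def wronskian {k : ℕ} (f : Fin k → ℂ → ℂ) (x : ℂ) : ℂ :=
  genWronskian f (fun b => (b : ℕ)) x

open Classical in
/-- A basis of a finite-dimensional space `V` of functions (zero if `V` is
infinite-dimensional). -/
def basisOf (V : Submodule ℂ (ℂ → ℂ)) : Fin (Module.finrank ℂ V) → ℂ → ℂ :=
  if _h : Module.Finite ℂ V then fun i => ((Module.finBasis ℂ V i : V) : ℂ → ℂ) else fun _ => 0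

/-- The Wronskian of `V` (well defined up to a nonzero constant). -/
def wronskianOf (V : Submodule ℂ (ℂ → ℂ)) (x : ℂ) : ℂ := wronskian (basisOf V) x

/-- The coefficient of `∂ᵏ` in the monic fundamental operator of `V`, where `N = dim V`:
`(-1)^(N-k)` times the determinant with the derivatives of orders `0, …, N` except `k`,
divided by the Wronskian of `V`. -/
def monicCoeff (V : Submodule ℂ (ℂ → ℂ)) (k : Fin (Module.finrank ℂ V + 1)) (x : ℂ) : ℂ :=
  (-1) ^ (Module.finrank ℂ V - (k : ℕ)) *
    genWronskian (basisOf V) (fun b => ((k.succAbove b : Fin (Module.finrank ℂ V + 1)) : ℕ)) x /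
      wronskianOf V x

/-- The monic fundamental operator of `V`, applied to the function `g`, at the point `x`. -/
def monicOperator (V : Submodule ℂ (ℂ → ℂ)) (g : ℂ → ℂ) (x : ℂ) : ℂ :=
  ∑ k : Fin (Module.finrank ℂ V + 1), monicCoeff V k x * iteratedDeriv (k : ℕ) g x

/-- The set of exponents of `V` at `z`: the orders at `z` of the nonzero elements of `V`. -/
def exponents (V : Submodule ℂ (ℂ → ℂ)) (z : ℂ) : Set ℤ :=
  {e | ∃ f ∈ V, meromorphicOrderAt f z = (e : WithTop ℤ)}

/-- The singular points of `V`: the points where the exponents are not `0, 1, …, dim V - 1`. -/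
def singularPoints (V : Submodule ℂ (ℂ → ℂ)) : Set ℂ :=
  {z | exponents V z ≠ Set.Ico (0 : ℤ) (Module.finrank ℂ V : ℤ)}

/-- The smallest natural number `m` such that the coefficients of `(x - z)ᵐ` times the monic
fundamental operator of `V` have no pole at `z`. -/
def poleOrder (V : Submodule ℂ (ℂ → ℂ)) (z : ℂ) : ℕ :=
  sInf {m : ℕ | ∀ k : Fin (Module.finrank ℂ V + 1),
    0 ≤ meromorphicOrderAt (fun x => (x - z) ^ m * monicCoeff V k x) z}

/-! ### The conjugate spaces and the integral transform -/

/-- The conjugate space of `V`, spanned by the functions `Wr(f₁, …, f_{N-1}) / Wr_V`. -/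
def conjugateSpace (V : Submodule ℂ (ℂ → ℂ)) : Submodule ℂ (ℂ → ℂ) :=
  Submodule.span ℂ {g | ∃ f : Fin (Module.finrank ℂ V - 1) → ℂ → ℂ, (∀ i, f i ∈ V) ∧
    g = fun x => wronskian f x / wronskianOf V x}

/-- The regularized conjugate space of `V`, spanned by the functions
`f · ∏ (x - z)^(-M_z)`, where `f` is in the conjugate space and the product is over the singular
points `z` of `V`. -/
def regConjugateSpace (V : Submodule ℂ (ℂ → ℂ)) : Submodule ℂ (ℂ → ℂ) :=
  Submodule.span ℂ {g | ∃ f ∈ conjugateSpace V,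
    g = fun x => f x * ∏ᶠ z ∈ singularPoints V, ((x - z) ^ poleOrder V z)⁻¹}

/-- The space bispectral dual to `V`, spanned by the functions `u ↦ ∮ e^{ux} f(x) dx`, where `f`
is in the regularized conjugate space and the integral is over a circle around a singular point
of `V` that has all the other singular points of `V` outside. -/
def dualSpace (V : Submodule ℂ (ℂ → ℂ)) : Submodule ℂ (ℂ → ℂ) :=
  Submodule.span ℂ {g | ∃ z ∈ singularPoints V, ∃ f ∈ regConjugateSpace V, ∃ r : ℝ, 0 < r ∧
    (∀ w ∈ singularPoints V, w ≠ z → r < dist w z) ∧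
    g = fun u => ∮ x in C(z, r), Complex.exp (u * x) * f x}

/-! ### Spaces of quasi-polynomials -/

/-- The linear map sending a polynomial `p` to the function `x ↦ p(x) e^{lx}`. -/
def expPoly (l : ℂ) : ℂ[X] →ₗ[ℂ] (ℂ → ℂ) where
  toFun p := fun x => p.eval x * Complex.exp (l * x)
  map_add' p q := by
    funext x
    simp [add_mul]
  map_smul' c p := by
    funext x
    simp [mul_assoc]

/-- `V` is a space of quasi-polynomials: it is spanned by functions `p_{ij}(x) e^{λ_i x}`,
`i = 1, …, n`, `j = 1, …, N_i`, with distinct `λ_i` and `0 < deg p_{i1} < … < deg p_{iN_i}`. -/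
def IsQuasiPolynomialSpace (V : Submodule ℂ (ℂ → ℂ)) : Prop :=
  ∃ (n : ℕ) (l : Fin n → ℂ) (N : Fin n → ℕ) (p : (i : Fin n) → Fin (N i) → ℂ[X]),
    0 < n ∧ Function.Injective l ∧ (∀ i, 0 < N i) ∧
    (∀ i j, 0 < (p i j).natDegree) ∧ (∀ i, StrictMono fun j => (p i j).natDegree) ∧
    V = Submodule.span ℂ {g | ∃ i j, g = expPoly (l i) (p i j)}

/-! ### The Grassmannian of admissible subspaces -/

/-- `W` is admissible at `l`: it contains `(t - l)ᵐ ℂ[t]` for some `m`, and an element which does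
not vanish at `l`. -/
def IsAdmissibleAt (l : ℂ) (W : Submodule ℂ ℂ[X]) : Prop :=
  (∃ m : ℕ, ∀ q : ℂ[X], (X - C l) ^ m * q ∈ W) ∧ ∃ f ∈ W, f.eval l ≠ 0

/-- The Grassmannian of admissible subspaces of `ℂ[t]`: finite intersections of subspaces
admissible at distinct points. -/
def Gr : Set (Submodule ℂ ℂ[X]) :=
  {W | ∃ (n : ℕ) (l : Fin n → ℂ) (Wl : Fin n → Submodule ℂ ℂ[X]),
    0 < n ∧ Function.Injective l ∧ (∀ i, IsAdmissibleAt (l i) (Wl i)) ∧ W = ⨅ i, Wl i}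

/-- For `p = ∑ c_a xᵃ`, the linear form `r ↦ ∑ c_a r⁽ᵃ⁾(l)` on `ℂ[t]`. -/
def condition (l : ℂ) (p : ℂ[X]) : ℂ[X] →ₗ[ℂ] ℂ :=
  ∑ a ∈ Finset.range (p.natDegree + 1),
    p.coeff a • (Polynomial.leval l ∘ₗ (Polynomial.derivative ^ a : Module.End ℂ ℂ[X]))

/-- The subspace of `ℂ[t]` corresponding to a space of quasi-polynomials `V`: every element
`p(x) e^{lx}` of `V`, with `p = ∑ c_a xᵃ`, imposes the equation `∑ c_a r⁽ᵃ⁾(l) = 0`. -/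
def subspaceOf (V : Submodule ℂ (ℂ → ℂ)) : Submodule ℂ ℂ[X] :=
  ⨅ (l : ℂ) (p : ℂ[X]) (_ : expPoly l p ∈ V), LinearMap.ker (condition l p)

/-- The space of quasi-polynomials associated with a subspace `W` of `ℂ[t]`, spanned by the
functions `p(x) e^{lx}`, with `p = ∑ c_a xᵃ`, such that the equation `∑ c_a r⁽ᵃ⁾(l) = 0` holds for
all `r` in `W`. -/
def quasiPolySpaceOf (W : Submodule ℂ ℂ[X]) : Submodule ℂ (ℂ → ℂ) :=
  Submodule.span ℂ {g | ∃ (l : ℂ) (p : ℂ[X]), W ≤ LinearMap.ker (condition l p) ∧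
    g = expPoly l p}

/-! ### The stationary Baker–Akhiezer function -/

/-- The number of basis functions of the form `p(x) e^{lx}` in a space of quasi-polynomials
`V`, that is, the dimension of the space of polynomials `p` with `p(x) e^{lx}` in `V`. -/
def multiplicity (V : Submodule ℂ (ℂ → ℂ)) (l : ℂ) : ℕ :=
  Module.finrank ℂ (V.comap (expPoly l))

/-- The stationary Baker–Akhiezer function
`Ψ_W(x, ξ) = ∏ (ξ - λ_i)^(-N_i) · D̄_V e^{xξ}`, where `V` is the space of quasi-polynomials
associated with `W`. -/
def bakerAkhiezer (W : Submodule ℂ ℂ[X]) (x ξ : ℂ) : ℂ :=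
  (∏ᶠ l : ℂ, (ξ - l) ^ multiplicity (quasiPolySpaceOf W) l)⁻¹ *
    monicOperator (quasiPolySpaceOf W) (fun y => Complex.exp (y * ξ)) x

/-- The points `(x, ξ)` at which the meromorphic function `Ψ_W` is given by its defining formula:
`x` is not a singular point of the space of quasi-polynomials `V` associated with `W`, and `ξ` is
not one of the `λ_i`. For admissible `W` this excludes finitely many `x` and finitely many `ξ`. -/
def bakerAkhiezerDomain (W : Submodule ℂ ℂ[X]) : Set (ℂ × ℂ) :=
  {q | q.1 ∉ singularPoints (quasiPolySpaceOf W) ∧ multiplicity (quasiPolySpaceOf W) q.2 = 0}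

/-- `W` and `Y` are bispectral dual with respect to their Baker–Akhiezer functions:
`Ψ_Y(x, ξ) = Ψ_W(ξ, x)` as meromorphic functions, i.e. wherever both sides are defined. -/
def IsBispectralDual (W Y : Submodule ℂ ℂ[X]) : Prop :=
  ∀ x ξ : ℂ, (x, ξ) ∈ bakerAkhiezerDomain Y → (ξ, x) ∈ bakerAkhiezerDomain W →
    bakerAkhiezer Y x ξ = bakerAkhiezer W ξ x

end

end Bispectral

namespace Bispectral

open Polynomial Topology Filter

/-! Let `P(x) = ∏ (x - z_a)^{M_a}`, `M = deg P`, and `Q(ξ) = ∏ (ξ - λ_i)^{N_i}`. Clearing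
denominators turns the monic operator of `V` into `P·D̄_V = ∑ a_{jk} x^j ∂^k` with `j ≤ M`, `k ≤ N`.
At infinity the coefficients of `D̄_V` tend to those of `Q(∂)`, so the terms with `j = M` add up to
`x^M Q(∂)` (`isProper_opCoeff`, `IsHomogeneousBasis.exists_polynomial`). Consequently `P(x) Q(ξ)
Ψ_W(x, ξ) = ∑ a_{jk} x^j ξ^k e^{xξ}`. The theorem follows once the operator with the roles
exchanged, `D' = ∑ a_{jk} u^k ∂_u^j`, is known to be `Q·D̄_U`, and the exponents of `U` are known to
be the `z_a` with multiplicities `M_a`: then both sides are the same double sum.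

Upper bound: `D'` has order `M` and leading coefficient `Q(u)`. Applied under the integral to `∮
e^{ux} g/P dx`, with `g` in the conjugate space, it gives `∮ g·D̄_V e^{ux} dx`. This vanishes
because `g·D̄_V y` is an exact derivative for every entire `y` (`hasDerivAt_wronskian_div`). So `D'`
annihilates `U`, and `dim U ≤ M` (`dualSpace_le_dualKernel`, `finrank_le_of_le_dualKernel`).

Lower bound: the transform at `z_a` kills `g/P` only if `g/P` is holomorphic there. A nonzero `g`
has order at most `N - 1` at `z_a`, so the order of `g/P` then lies in `[0, N - 1 - M_a]`, and the
kernel has dimension at most `N - M_a`. The image, made of quasi-polynomials with exponent `z_a`,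
has dimension at least `M_a` (`poleOrder_le_multiplicity`). Summing over `a` gives `dim U ≥ M`, so
all the bounds are equalities and `Q⁻¹D' = D̄_U` by uniqueness of the monic operator.

The local estimates rest on `le_meromorphicOrderAt_opCoeff`: at each point the coefficient of `∂^k`
has a pole of order at most `N - k`. It is proved by splitting off first-order factors `∂ - h'/h`.

The passage between `V` and `W` is linear duality: the equation imposed by `p(x) e^{λx}` is `r ↦
r(∂)(p e^{λx})(0)`, and an entire function is determined by this functional
(`condition_eq_taylorForm`, `taylorForm_injective`). -/

/-! ### Entire functions and their Taylor forms -/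

/-- The space of entire functions. -/
def entire : Submodule ℂ (ℂ → ℂ) where
  carrier := {f | Differentiable ℂ f}
  add_mem' hf hg := hf.add hg
  zero_mem' := differentiable_const 0
  smul_mem' c _ hf := hf.const_smul c

theorem mem_entire {f : ℂ → ℂ} : f ∈ entire ↔ Differentiable ℂ f := Iff.rfl

theorem entire_contDiffAt {f : ℂ → ℂ} (hf : f ∈ entire) (n : WithTop ℕ∞) (x : ℂ) :
    ContDiffAt ℂ n f x := (mem_entire.1 hf).contDiff.contDiffAt

theorem iteratedDeriv_mem_entire {f : ℂ → ℂ} (hf : f ∈ entire) (n : ℕ) :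
    iteratedDeriv n f ∈ entire := by
  induction n with
  | zero => simpa using hf
  | succ n ih =>
    rw [iteratedDeriv_succ]
    exact (mem_entire.1 ih).deriv

theorem hasDerivAt_iteratedDeriv {f : ℂ → ℂ} (hf : f ∈ entire) (n : ℕ) (x : ℂ) :
    HasDerivAt (iteratedDeriv n f) (iteratedDeriv (n + 1) f x) x := by
  rw [iteratedDeriv_succ]
  exact (mem_entire.1 (iteratedDeriv_mem_entire hf n) x).hasDerivAt

theorem iteratedDeriv_sum_smul {ι : Type*} (s : Finset ι) (c : ι → ℂ) (f : ι → ℂ → ℂ)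
    (hf : ∀ i, f i ∈ entire) (n : ℕ) (x : ℂ) :
    iteratedDeriv n (∑ i ∈ s, c i • f i) x = ∑ i ∈ s, c i * iteratedDeriv n (f i) x := by
  classical
  induction s using Finset.induction_on with
  | empty =>
    simp only [Finset.sum_empty]
    rw [show (0 : ℂ → ℂ) = fun _ => (0 : ℂ) from rfl, iteratedDeriv_const]
    simp
  | insert a s ha ih =>
    rw [Finset.sum_insert ha, Finset.sum_insert ha, iteratedDeriv_add, ih,
      iteratedDeriv_const_smul_field]
    · simp
    · exact entire_contDiffAt (entire.smul_mem _ (hf a)) _ _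
    · exact entire_contDiffAt (entire.sum_mem fun i _ => entire.smul_mem _ (hf i)) _ _

/-- The linear form `r ↦ r(∂) f (0)` on polynomials attached to an entire function `f`. -/
noncomputable def taylorForm : entire →ₗ[ℂ] ℂ[X] →ₗ[ℂ] ℂ where
  toFun f := Polynomial.lsum fun n => iteratedDeriv n (f : ℂ → ℂ) 0 • LinearMap.id
  map_add' f g := by
    ext n
    simp [Polynomial.lsum_apply, Polynomial.sum_monomial_index,
      iteratedDeriv_add (entire_contDiffAt f.2 _ _) (entire_contDiffAt g.2 _ _)]
  map_smul' c f := by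
    ext n
    simp [Polynomial.lsum_apply, Polynomial.sum_monomial_index]

theorem taylorForm_X_pow (f : entire) (n : ℕ) :
    taylorForm f (X ^ n) = iteratedDeriv n (f : ℂ → ℂ) 0 := by
  rw [← monomial_one_right_eq_X_pow]
  simp [taylorForm, Polynomial.lsum_apply, Polynomial.sum_monomial_index]

/-- The values on the powers of `X` are the Taylor data at `0`, and the Taylor series of an entire
function converges to it everywhere. -/
theorem taylorForm_injective : Function.Injective taylorForm := by
  refine (injective_iff_map_eq_zero _).2 fun f hf => ?_
  ext z
  have h := Complex.taylorSeries_eq_of_entire (mem_entire.1 f.2) 0 z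
  rw [← h]
  have : ∀ n, iteratedDeriv n (f : ℂ → ℂ) 0 = 0 := fun n => by
    rw [← taylorForm_X_pow, hf]; rfl
  simp [this]

/-- The operator `p ↦ p' + l p`, which corresponds to the derivative of `p(x) e^{lx}`. -/
noncomputable def twistedDeriv (l : ℂ) (p : ℂ[X]) : ℂ[X] := derivative p + C l * p

theorem hasDerivAt_expPoly (l : ℂ) (p : ℂ[X]) (x : ℂ) :
    HasDerivAt (expPoly l p) (expPoly l (twistedDeriv l p) x) x := by
  have h1 := p.hasDerivAt x
  have h2 : HasDerivAt (fun x : ℂ => Complex.exp (l * x)) (Complex.exp (l * x) * (l * 1)) x :=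
    ((hasDerivAt_id x).const_mul l).cexp
  have := h1.mul h2
  convert! this using 1
  simp [expPoly, twistedDeriv]
  ring

theorem expPoly_mem_entire (l : ℂ) (p : ℂ[X]) : expPoly l p ∈ entire :=
  fun x => (hasDerivAt_expPoly l p x).differentiableAt

theorem iteratedDeriv_expPoly (l : ℂ) (p : ℂ[X]) (n : ℕ) :
    iteratedDeriv n (expPoly l p) = expPoly l ((twistedDeriv l)^[n] p) := by
  induction n with
  | zero => simp
  | succ n ih =>
    rw [iteratedDeriv_succ, ih, Function.iterate_succ_apply']
    funext x
    exact (hasDerivAt_expPoly l _ x).deriv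

theorem condition_apply (l : ℂ) (p r : ℂ[X]) :
    condition l p r = p.sum fun a c => c * (derivative^[a] r).eval l := by
  rw [Polynomial.sum_over_range _ (by simp)]
  simp [condition, Polynomial.leval, Module.End.pow_apply]

theorem condition_add (l : ℂ) (p q r : ℂ[X]) :
    condition l (p + q) r = condition l p r + condition l q r := by
  simp only [condition_apply]
  exact Polynomial.sum_add_index _ _ _ (by simp) (by intros; ring)

/-- Leibniz's rule for `(X r)⁽ᵃ⁾`. Multiplication by `X` on the polynomial side is differentiation
on the quasi-polynomial side. -/
theorem condition_X_mul (l : ℂ) (p r : ℂ[X]) :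
    condition l p (X * r) = condition l (twistedDeriv l p) r := by
  induction p using Polynomial.induction_on' with
  | add p q hp hq =>
    have : twistedDeriv l (p + q) = twistedDeriv l p + twistedDeriv l q := by
      simp [twistedDeriv]; ring
    rw [condition_add, hp, hq, this, condition_add]
  | monomial n c =>
    rw [twistedDeriv, condition_add, derivative_monomial, C_mul_monomial]
    simp only [condition_apply]
    rw [Polynomial.sum_monomial_index _ _ (by simp), Polynomial.sum_monomial_index _ _ (by simp),
      Polynomial.sum_monomial_index _ _ (by simp), mul_comm X r]
    rw [Polynomial.iterate_derivative_mul_X]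
    simp
    ring

theorem condition_one (l : ℂ) (p : ℂ[X]) : condition l p 1 = p.eval 0 := by
  induction p using Polynomial.induction_on' with
  | add p q hp hq => simp [condition_add, hp, hq]
  | monomial n c =>
    rw [condition_apply, Polynomial.sum_monomial_index _ _ (by simp)]
    rcases n with _ | n
    · simp
    · simp [Polynomial.iterate_derivative_one]

theorem condition_eq_taylorForm (l : ℂ) (p : ℂ[X]) :
    condition l p = taylorForm ⟨expPoly l p, expPoly_mem_entire l p⟩ := by
  refine Polynomial.lhom_ext' fun n => LinearMap.ext_ring ?_
  simp only [LinearMap.comp_apply, monomial_one_right_eq_X_pow, taylorForm_X_pow]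
  rw [iteratedDeriv_expPoly]
  have : condition l p (X ^ n) = ((twistedDeriv l)^[n] p).eval 0 := by
    induction n generalizing p with
    | zero => simpa using condition_one l p
    | succ n ih => rw [pow_succ', condition_X_mul, ih, Function.iterate_succ_apply]
  rw [this]
  simp [expPoly]

theorem expPoly_injective (l : ℂ) : Function.Injective (expPoly l) := by
  refine (injective_iff_map_eq_zero _).2 fun p hp => Polynomial.funext fun x => ?_
  have := congrFun hp x
  simpa [expPoly, Complex.exp_ne_zero] using this

/-- Only derivatives of order at most `deg p < m` enter, and these still vanish at `l`. -/
theorem condition_X_sub_C_pow_mul (l : ℂ) (p q : ℂ[X]) {m : ℕ} (hm : p.natDegree < m) :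
    condition l p ((X - C l) ^ m * q) = 0 := by
  rw [condition_apply, Polynomial.sum_over_range _ (by simp)]
  refine Finset.sum_eq_zero fun a ha => ?_
  have ha' : a < m := by
    have := Finset.mem_range.1 ha
    omega
  have hdvd : (X - C l) ^ (m - a) ∣ derivative^[a] ((X - C l) ^ m * q) :=
    Polynomial.pow_sub_dvd_iterate_derivative_of_pow_dvd a (dvd_mul_right _ _)
  obtain ⟨s, hs⟩ := hdvd
  rw [hs]
  have : m - a ≠ 0 := by omega
  simp [this]

/-! ### Independence of quasi-polynomials with distinct exponents -/

/-- The transpose of the multiplication by `X`. -/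
noncomputable def shiftForm : Module.End ℂ (ℂ[X] →ₗ[ℂ] ℂ) where
  toFun φ := φ ∘ₗ LinearMap.mulLeft ℂ X
  map_add' _ _ := rfl
  map_smul' _ _ := rfl

theorem shiftForm_sub_pow_apply (l : ℂ) (m : ℕ) (φ : ℂ[X] →ₗ[ℂ] ℂ) (r : ℂ[X]) :
    ((shiftForm - l • (1 : Module.End ℂ (ℂ[X] →ₗ[ℂ] ℂ))) ^ m) φ r = φ ((X - C l) ^ m * r) := by
  induction m generalizing φ with
  | zero => simp
  | succ m ih =>
    rw [pow_succ, Module.End.mul_apply, ih, pow_succ', mul_assoc, sub_mul]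
    simp [shiftForm, ← Polynomial.smul_eq_C_mul]

theorem condition_mem_maxGenEigenspace (l : ℂ) (p : ℂ[X]) :
    condition l p ∈ shiftForm.maxGenEigenspace l := by
  rw [Module.End.mem_maxGenEigenspace]
  refine ⟨p.natDegree + 1, LinearMap.ext fun r => ?_⟩
  rw [shiftForm_sub_pow_apply, condition_X_sub_C_pow_mul l p r (Nat.lt_succ_self _)]
  rfl

/-- The linear form of `p(x) e^{lx}` is a generalized eigenvector, with eigenvalue `l`, of the
transpose of multiplication by `X`. Generalized eigenspaces for distinct eigenvalues are
independent. -/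
theorem expPoly_eq_zero_of_sum_eq_zero (S : Finset ℂ) (p : ℂ → ℂ[X])
    (h : ∑ l ∈ S, expPoly l (p l) = 0) : ∀ l ∈ S, p l = 0 := by
  have hind := Module.End.independent_maxGenEigenspace (R := ℂ) shiftForm
  rw [iSupIndep_iff_finsetSum_eq_zero_imp_eq_zero] at hind
  have hsum : ∑ l ∈ S, condition l (p l) = 0 := by
    simp only [condition_eq_taylorForm]
    rw [← map_sum]
    have : ∑ l ∈ S, (⟨expPoly l (p l), expPoly_mem_entire l (p l)⟩ : entire) = 0 := by
      ext1
      simpa using h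
    rw [this, map_zero]
  intro l hl
  have h0 := hind S (fun l => condition l (p l))
    (fun l _ => condition_mem_maxGenEigenspace l (p l)) hsum l hl
  rw [condition_eq_taylorForm] at h0
  have := taylorForm_injective (h0.trans (map_zero taylorForm).symm)
  have h1 : expPoly l (p l) = 0 := congrArg Subtype.val this
  exact expPoly_injective l (h1.trans (map_zero _).symm)

theorem sum_multiplicity_le (U : Submodule ℂ (ℂ → ℂ)) [FiniteDimensional ℂ U] (S : Finset ℂ) :
    ∑ l ∈ S, multiplicity U l ≤ Module.finrank ℂ U := by
  classical
  have hfin : ∀ l, FiniteDimensional ℂ (U.comap (expPoly l)) := fun l =>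
    FiniteDimensional.of_injective ((expPoly l).restrict (p := U.comap (expPoly l)) (q := U)
      fun _ h => h) fun a b hab => Subtype.ext (expPoly_injective l (congrArg Subtype.val hab))
  let F : ((l : S) → U.comap (expPoly (l : ℂ))) →ₗ[ℂ] U :=
    ∑ l : S, ((expPoly (l : ℂ)).restrict (p := U.comap (expPoly l)) (q := U) fun _ h => h) ∘ₗ
      LinearMap.proj l
  have hF : Function.Injective F := by
    refine (injective_iff_map_eq_zero _).2 fun v hv => ?_
    have h0 : ∑ l : S, expPoly (l : ℂ) (v l : ℂ[X]) = 0 := by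
      have := congrArg Subtype.val hv
      simpa [F] using this
    let p : ℂ → ℂ[X] := fun l => if h : l ∈ S then (v ⟨l, h⟩ : ℂ[X]) else 0
    have h1 : ∑ l ∈ S, expPoly l (p l) = 0 := by
      rw [← Finset.sum_coe_sort S, ← h0]
      exact Finset.sum_congr rfl fun l _ => by simp [p]
    funext l
    have := expPoly_eq_zero_of_sum_eq_zero S p h1 l l.2
    ext1
    simpa [p] using this
  have := LinearMap.finrank_le_finrank_of_injective hF
  rw [Module.finrank_pi_fintype] at this
  rw [← Finset.sum_coe_sort S]
  exact this

/-! ### Homogeneous bases and multiplicities -/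

/-- A linearly independent family of functions `p(x) e^{lx}` spanning `V`. -/
structure IsHomogeneousBasis {N : ℕ} (V : Submodule ℂ (ℂ → ℂ)) (l : Fin N → ℂ)
    (p : Fin N → ℂ[X]) : Prop where
  linearIndependent : LinearIndependent ℂ fun a => expPoly (l a) (p a)
  span_eq : Submodule.span ℂ (Set.range fun a => expPoly (l a) (p a)) = V

/-- A basis is extracted from the finite generating set, so the independence of the given generators
need not be proved. -/
theorem IsQuasiPolynomialSpace.exists_homogeneousBasis {V : Submodule ℂ (ℂ → ℂ)}
    (hV : IsQuasiPolynomialSpace V) :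
    ∃ (N : ℕ) (l : Fin N → ℂ) (p : Fin N → ℂ[X]), IsHomogeneousBasis V l p := by
  obtain ⟨n, l, N, p, -, -, -, -, -, rfl⟩ := hV
  set s : Set (ℂ → ℂ) := {g | ∃ i j, g = expPoly (l i) (p i j)} with hs
  have hsfin : s.Finite := by
    have : s = Set.range fun ij : Σ i, Fin (N i) => expPoly (l ij.1) (p ij.1 ij.2) := by
      ext g
      simp [hs, eq_comm]
    rw [this]
    exact Set.finite_range _
  obtain ⟨b, hbs, hspan, hind⟩ := exists_linearIndependent ℂ s
  have hbfin : b.Finite := hsfin.subset hbs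
  have : Fintype b := hbfin.fintype
  let e := (Fintype.equivFin b).symm
  have hmem : ∀ a, ∃ (m : ℂ) (q : ℂ[X]), (e a : ℂ → ℂ) = expPoly m q := fun a => by
    obtain ⟨i, j, h⟩ := hbs (e a).2
    exact ⟨_, _, h⟩
  choose m q hmq using hmem
  refine ⟨Fintype.card b, m, q, ?_, ?_⟩
  · simp only [← hmq]
    exact hind.comp e e.injective
  · simp only [← hmq]
    rw [← hspan]
    congr 1
    ext g
    constructor
    · rintro ⟨a, rfl⟩
      exact (e a).2
    · intro hg
      exact ⟨e.symm ⟨g, hg⟩, by simp⟩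

namespace IsHomogeneousBasis

variable {N : ℕ} {V : Submodule ℂ (ℂ → ℂ)} {l : Fin N → ℂ} {p : Fin N → ℂ[X]}

theorem finiteDimensional (h : IsHomogeneousBasis V l p) : FiniteDimensional ℂ V := by
  rw [← h.span_eq]
  exact FiniteDimensional.span_of_finite ℂ (Set.finite_range _)

theorem finrank_eq (h : IsHomogeneousBasis V l p) : Module.finrank ℂ V = N := by
  rw [← h.span_eq, finrank_span_eq_card h.linearIndependent, Fintype.card_fin]

theorem mem (h : IsHomogeneousBasis V l p) (a : Fin N) : expPoly (l a) (p a) ∈ V := by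
  rw [← h.span_eq]
  exact Submodule.subset_span ⟨a, rfl⟩

theorem mem_iff (h : IsHomogeneousBasis V l p) {f : ℂ → ℂ} :
    f ∈ V ↔ ∃ c : Fin N → ℂ, ∑ a, c a • expPoly (l a) (p a) = f := by
  rw [← h.span_eq, Submodule.mem_span_range_iff_exists_fun]

end IsHomogeneousBasis

/-! ### Duality between quasi-polynomials and linear conditions on polynomials -/

theorem condition_eq_sum {ι : Type*} [Fintype ι] {l₀ : ℂ} {q : ℂ[X]} {l : ι → ℂ} {p : ι → ℂ[X]}
    {c : ι → ℂ} : condition l₀ q = ∑ a, c a • condition (l a) (p a) ↔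
      expPoly l₀ q = ∑ a, c a • expPoly (l a) (p a) := by
  simp only [condition_eq_taylorForm, ← map_smul, ← map_sum]
  rw [taylorForm_injective.eq_iff, ← Subtype.coe_injective.eq_iff]
  simp

/-- The linear forms `condition l p` vanishing on the common kernel of finitely many others are
their linear combinations. -/
theorem exists_expPoly_eq_sum {ι : Type*} [Fintype ι] {l₀ : ℂ} {q : ℂ[X]} {l : ι → ℂ}
    {p : ι → ℂ[X]}
    (h : ⨅ a, LinearMap.ker (condition (l a) (p a)) ≤ LinearMap.ker (condition l₀ q)) :
    ∃ c : ι → ℂ, expPoly l₀ q = ∑ a, c a • expPoly (l a) (p a) := by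
  obtain ⟨c, hc⟩ := (Submodule.mem_span_range_iff_exists_fun ℂ).1 (mem_span_of_iInf_ker_le_ker h)
  exact ⟨c, condition_eq_sum.1 hc.symm⟩

theorem subspaceOf_span {ι : Type*} [Fintype ι] (l : ι → ℂ) (p : ι → ℂ[X]) :
    subspaceOf (Submodule.span ℂ (Set.range fun a => expPoly (l a) (p a))) =
      ⨅ a, LinearMap.ker (condition (l a) (p a)) := by
  refine le_antisymm (le_iInf fun a => ?_) ?_
  · exact iInf_le_of_le (l a) (iInf_le_of_le (p a) (iInf_le _ (Submodule.subset_span (Set.mem_range_self a))))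
  · refine le_iInf fun m => le_iInf fun q => le_iInf fun hq => ?_
    obtain ⟨c, hc⟩ := (Submodule.mem_span_range_iff_exists_fun ℂ).1 hq
    rw [condition_eq_sum.2 hc.symm]
    intro r hr
    rw [Submodule.mem_iInf] at hr
    rw [LinearMap.mem_ker, LinearMap.sum_apply]
    exact Finset.sum_eq_zero fun a _ => by
      rw [LinearMap.smul_apply, LinearMap.mem_ker.1 (hr a), smul_zero]

theorem IsHomogeneousBasis.quasiPolySpaceOf_subspaceOf {N : ℕ} {V : Submodule ℂ (ℂ → ℂ)}
    {l : Fin N → ℂ} {p : Fin N → ℂ[X]} (h : IsHomogeneousBasis V l p) :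
    quasiPolySpaceOf (subspaceOf V) = V := by
  have hW : subspaceOf V = ⨅ a, LinearMap.ker (condition (l a) (p a)) := by
    rw [← h.span_eq, subspaceOf_span]
  refine le_antisymm (Submodule.span_le.2 ?_) ?_
  · rintro _ ⟨m, q, hle, rfl⟩
    rw [hW] at hle
    obtain ⟨c, hc⟩ := exists_expPoly_eq_sum hle
    exact h.mem_iff.2 ⟨c, hc.symm⟩
  · conv_lhs => rw [← h.span_eq]
    rw [Submodule.span_le]
    rintro _ ⟨a, rfl⟩
    exact Submodule.subset_span ⟨_, _, hW.le.trans (iInf_le _ a), rfl⟩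

/-- The lower bounds already fill the dimension, so each is sharp and no room is left for a further
exponent. It serves `V`, with the number of basis functions for each exponent, and the dual space,
with the pole orders. -/
theorem multiplicity_eq_of_le {U : Submodule ℂ (ℂ → ℂ)} [FiniteDimensional ℂ U] {m : ℂ → ℕ}
    {S : Finset ℂ} (hm : ∀ l ∈ S, m l ≤ multiplicity U l)
    (hS : Module.finrank ℂ U ≤ ∑ l ∈ S, m l) :
    (∀ l ∈ S, multiplicity U l = m l) ∧ ∀ l ∉ S, multiplicity U l = 0 := by
  classical
  have h1 := Finset.sum_le_sum hm
  have h2 := sum_multiplicity_le U S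
  refine ⟨fun l hl => ?_, fun l hl => ?_⟩
  · exact ((Finset.sum_eq_sum_iff_of_le hm).1 (by omega) l hl).symm
  · have h3 := sum_multiplicity_le U (insert l S)
    rw [Finset.sum_insert hl] at h3
    omega

theorem finprod_multiplicity_eq {U : Submodule ℂ (ℂ → ℂ)} {m : ℂ → ℕ} {S : Finset ℂ}
    (h1 : ∀ l ∈ S, multiplicity U l = m l) (h2 : ∀ l ∉ S, multiplicity U l = 0) (ξ : ℂ) :
    ∏ᶠ l : ℂ, (ξ - l) ^ multiplicity U l = ∏ l ∈ S, (ξ - l) ^ m l := by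
  rw [finprod_eq_prod_of_mulSupport_subset (s := S)]
  · exact Finset.prod_congr rfl fun l hl => by rw [h1 l hl]
  · intro l hl
    by_contra hS
    exact hl (by simp [h2 l hS])

namespace IsHomogeneousBasis

variable {N : ℕ} {V : Submodule ℂ (ℂ → ℂ)} {l : Fin N → ℂ} {p : Fin N → ℂ[X]}

theorem card_le_multiplicity [DecidableEq ℂ] (h : IsHomogeneousBasis V l p) (m : ℂ) :
    (Finset.univ.filter fun a => l a = m).card ≤ multiplicity V m := by
  have := h.finiteDimensional
  have hfin : FiniteDimensional ℂ (V.comap (expPoly m)) :=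
    FiniteDimensional.of_injective ((expPoly m).restrict (p := V.comap (expPoly m)) (q := V)
      fun _ h => h) fun a b hab => Subtype.ext (expPoly_injective m (congrArg Subtype.val hab))
  let v : {a // l a = m} → V.comap (expPoly m) := fun a => ⟨p a, by
    have := h.mem a
    rw [a.2] at this
    exact this⟩
  have hv : LinearIndependent ℂ v := by
    have h1 := h.linearIndependent.comp (fun a : {a // l a = m} => (a : Fin N))
      Subtype.val_injective
    have h2 : ((fun a => expPoly (l a) (p a)) ∘ fun a : {a // l a = m} => (a : Fin N)) =
        (expPoly m ∘ₗ (V.comap (expPoly m)).subtype) ∘ v := by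
      funext a
      simp [v, a.2]
    rw [h2] at h1
    exact LinearIndependent.of_comp _ h1
  have := hv.fintype_card_le_finrank
  rwa [Fintype.card_subtype] at this

theorem multiplicity_eq [DecidableEq ℂ] (h : IsHomogeneousBasis V l p) :
    (∀ m ∈ Finset.univ.image l,
      multiplicity V m = (Finset.univ.filter fun a => l a = m).card) ∧
    ∀ m ∉ Finset.univ.image l, multiplicity V m = 0 := by
  have := h.finiteDimensional
  refine multiplicity_eq_of_le (fun m _ => h.card_le_multiplicity m) ?_
  rw [h.finrank_eq, ← Finset.card_eq_sum_card_image, Finset.card_univ, Fintype.card_fin]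

theorem finprod_multiplicity (h : IsHomogeneousBasis V l p) (ξ : ℂ) :
    ∏ᶠ m : ℂ, (ξ - m) ^ multiplicity V m = ∏ a, (ξ - l a) := by
  classical
  rw [finprod_multiplicity_eq h.multiplicity_eq.1 h.multiplicity_eq.2]
  rw [← Finset.prod_fiberwise_of_maps_to (t := Finset.univ.image l) (g := l)
    (fun a ha => Finset.mem_image_of_mem _ ha)]
  refine Finset.prod_congr rfl fun m _ => ?_
  rw [Finset.prod_congr rfl (g := fun _ => ξ - m)
    fun a ha => by rw [(Finset.mem_filter.1 ha).2], Finset.prod_const]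

end IsHomogeneousBasis

/-! ### Admissibility -/

/-- The largest index with a nonzero coefficient contributes a leading term of positive degree that
nothing cancels. -/
theorem sum_smul_ne_one_of_natDegree_strictMono {n : ℕ} {p : Fin n → ℂ[X]}
    (hpos : ∀ j, 0 < (p j).natDegree) (hmono : StrictMono fun j => (p j).natDegree)
    (c : Fin n → ℂ) : ∑ j, c j • p j ≠ 1 := by
  intro h
  by_cases hc : ∃ j, c j ≠ 0
  · obtain ⟨j, hj, hmax⟩ := (Finset.univ.filter fun j => c j ≠ 0).exists_max_image id
      (by obtain ⟨j, hj⟩ := hc; exact ⟨j, by simpa using hj⟩)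
    have hcoef := congrArg (fun q => q.coeff (p j).natDegree) h
    simp only [finsetSum_coeff, coeff_smul, coeff_one, (hpos j).ne', if_false] at hcoef
    rw [Finset.sum_eq_single j] at hcoef
    · have hp : p j ≠ 0 := fun h0 => by simpa [h0] using hpos j
      have : (p j).leadingCoeff ≠ 0 := leadingCoeff_ne_zero.2 hp
      exact (mul_ne_zero (by simpa using hj) this) hcoef
    · intro i _ hij
      by_cases hi : c i = 0
      · simp [hi]
      · have : i < j := lt_of_le_of_ne (hmax i (by simpa using hi)) hij
        rw [coeff_eq_zero_of_natDegree_lt (hmono this), smul_zero]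
    · simp
  · push Not at hc
    simp [hc] at h

theorem IsQuasiPolynomialSpace.subspaceOf_mem_Gr {V : Submodule ℂ (ℂ → ℂ)}
    (hV : IsQuasiPolynomialSpace V) : subspaceOf V ∈ Gr := by
  obtain ⟨n, l, N, p, hn, hl, -, hpos, hmono, rfl⟩ := hV
  refine ⟨n, l, fun i => ⨅ j, LinearMap.ker (condition (l i) (p i j)), hn, hl, fun i => ⟨?_, ?_⟩, ?_⟩
  -- The sum of the degrees is a crude bound for each of them.
  · refine ⟨(∑ j, (p i j).natDegree) + 1, fun q => ?_⟩
    rw [Submodule.mem_iInf]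
    intro j
    refine condition_X_sub_C_pow_mul _ _ _ (Nat.lt_succ_of_le ?_)
    exact Finset.single_le_sum (f := fun j => (p i j).natDegree) (fun _ _ => Nat.zero_le _)
      (Finset.mem_univ j)
  -- Otherwise evaluation at `l i`, the condition attached to the polynomial `1`, vanishes on the
  -- common kernel. Then `1` is a combination of the `p i j`, which their positive, distinct degrees
  -- forbid.
  · by_contra! hcon
    have hle : ⨅ j, LinearMap.ker (condition (l i) (p i j)) ≤
        LinearMap.ker (condition (l i) 1) := fun r hr => by
      have := hcon r hr
      rw [LinearMap.mem_ker, condition_apply, ← C_1, Polynomial.sum_C_index (by simp)]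
      simpa using this
    obtain ⟨c, hc⟩ := exists_expPoly_eq_sum hle
    refine sum_smul_ne_one_of_natDegree_strictMono (hpos i) (hmono i) c
      (expPoly_injective (l i) ?_)
    rw [hc, map_sum]
    simp
  · have hrange : {g | ∃ i j, g = expPoly (l i) (p i j)} =
        Set.range fun ij : Σ i, Fin (N i) => expPoly (l ij.1) (p ij.1 ij.2) := by
      ext g
      simp [eq_comm]
    rw [hrange, subspaceOf_span, iInf_sigma]

/-! ### Wronskians -/

theorem eventually_ne_zero_of_entire {w : ℂ → ℂ} (hw : w ∈ entire) (hne : ∃ x, w x ≠ 0) (z : ℂ) :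
    ∀ᶠ x in 𝓝[≠] z, w x ≠ 0 := by
  by_contra hcon
  rw [Filter.not_eventually] at hcon
  have han : AnalyticOnNhd ℂ w Set.univ := fun x _ => (mem_entire.1 hw).analyticAt x
  have := han.eqOn_zero_of_preconnected_of_frequently_eq_zero isPreconnected_univ
    (Set.mem_univ z) (by simpa using hcon)
  obtain ⟨x, hx⟩ := hne
  exact hx (this (Set.mem_univ x))

theorem eq_zero_of_entire_of_eventuallyEq {w : ℂ → ℂ} (hw : w ∈ entire) {z : ℂ}
    (h : ∀ᶠ x in 𝓝[≠] z, w x = 0) : w = 0 := by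
  by_contra hne
  have := eventually_ne_zero_of_entire hw (by
    by_contra! hcon
    exact hne (funext hcon)) z
  obtain ⟨x, h1, h2⟩ := (h.and this).exists
  exact h2 h1

theorem genWronskian_mem_entire {N : ℕ} {f : Fin N → ℂ → ℂ} (hf : ∀ a, f a ∈ entire)
    (d : Fin N → ℕ) : genWronskian f d ∈ entire := by
  have : genWronskian f d = fun x => ∑ σ : Equiv.Perm (Fin N), (Equiv.Perm.sign σ : ℂ) *
      ∏ i, iteratedDeriv (d i) (f (σ i)) x := by
    funext x
    rw [genWronskian, Matrix.det_apply']
    rfl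
  rw [this]
  refine mem_entire.2 (Differentiable.fun_sum fun σ _ => Differentiable.const_mul ?_ _)
  exact Differentiable.fun_finsetProd fun i _ => iteratedDeriv_mem_entire (hf _) _

theorem wronskian_mem_entire {N : ℕ} {f : Fin N → ℂ → ℂ} (hf : ∀ a, f a ∈ entire) :
    wronskian f ∈ entire := genWronskian_mem_entire hf _

theorem genWronskian_sum_smul {N : ℕ} {f : Fin N → ℂ → ℂ} (hf : ∀ a, f a ∈ entire)
    (T : Matrix (Fin N) (Fin N) ℂ) (d : Fin N → ℕ) (x : ℂ) :
    genWronskian (fun i => ∑ a, T i a • f a) d x = T.det * genWronskian f d x := by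
  rw [genWronskian, genWronskian, ← Matrix.det_mul]
  congr 1
  ext i b
  simp [Matrix.mul_apply, iteratedDeriv_sum_smul _ _ _ hf]

/-- The coefficient of `∂ᵏ` in the monic operator of order `N` annihilating `f₁, …, f_N`. -/
noncomputable def opCoeff {N : ℕ} (f : Fin N → ℂ → ℂ) (k : Fin (N + 1)) (x : ℂ) : ℂ :=
  (-1) ^ (N - (k : ℕ)) * genWronskian f (fun b => ((k.succAbove b : Fin (N + 1)) : ℕ)) x /
    wronskian f x

/-- The monic operator annihilating `f₁, …, f_N`, applied to `g`. -/
noncomputable def monicOp {N : ℕ} (f : Fin N → ℂ → ℂ) (g : ℂ → ℂ) (x : ℂ) : ℂ :=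
  ∑ k : Fin (N + 1), opCoeff f k x * iteratedDeriv (k : ℕ) g x

/-- Laplace expansion along the row of `g`. It identifies the monic operator with the quotient
`Wr(f, g)/Wr(f)`. -/
theorem wronskian_snoc {N : ℕ} (f : Fin N → ℂ → ℂ) (g : ℂ → ℂ) (x : ℂ) :
    wronskian (Fin.snoc f g : Fin (N + 1) → ℂ → ℂ) x = ∑ k : Fin (N + 1),
      (-1) ^ (N - (k : ℕ)) * genWronskian f (fun b => ((k.succAbove b : Fin (N + 1)) : ℕ)) x *
        iteratedDeriv (k : ℕ) g x := by
  rw [wronskian, genWronskian, Matrix.det_succ_row _ (Fin.last N)]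
  refine Finset.sum_congr rfl fun k _ => ?_
  have h1 : ((-1 : ℂ)) ^ (N + (k : ℕ)) = (-1) ^ (N - (k : ℕ)) := by
    have hk : (k : ℕ) ≤ N := Nat.lt_succ_iff.1 k.2
    have : N + (k : ℕ) = (N - k) + 2 * k := by omega
    rw [this, pow_add, pow_mul]
    simp
  have h2 : (Matrix.submatrix (Matrix.of fun a b : Fin (N + 1) =>
      iteratedDeriv (b : ℕ) ((Fin.snoc f g : Fin (N + 1) → ℂ → ℂ) a) x)
      (Fin.last N).succAbove k.succAbove) = Matrix.of fun a b : Fin N =>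
        iteratedDeriv ((k.succAbove b : Fin (N + 1)) : ℕ) (f a) x := by
    ext a b
    simp
  rw [h2, Fin.val_last, h1, genWronskian]
  simp
  ring

theorem monicOp_eq {N : ℕ} (f : Fin N → ℂ → ℂ) (g : ℂ → ℂ) (x : ℂ) :
    monicOp f g x = wronskian (Fin.snoc f g : Fin (N + 1) → ℂ → ℂ) x / wronskian f x := by
  rw [wronskian_snoc, Finset.sum_div]
  exact Finset.sum_congr rfl fun k _ => by rw [opCoeff]; ring

theorem monicOp_self {N : ℕ} (f : Fin N → ℂ → ℂ) (a : Fin N) (x : ℂ) : monicOp f (f a) x = 0 := by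
  rw [monicOp_eq, wronskian, genWronskian,
    Matrix.det_zero_of_row_eq (i := a.castSucc) (j := Fin.last N) (Fin.castSucc_lt_last a).ne,
    zero_div]
  ext b
  simp

theorem opCoeff_last {N : ℕ} {f : Fin N → ℂ → ℂ} {x : ℂ} (hx : wronskian f x ≠ 0) :
    opCoeff f (Fin.last N) x = 1 := by
  have : genWronskian f (fun b => (((Fin.last N).succAbove b : Fin (N + 1)) : ℕ)) x =
      wronskian f x := by
    simp [wronskian]
  rw [opCoeff, this]
  simp [hx]

theorem eq_zero_of_sum_mul_iteratedDeriv {N : ℕ} {f : Fin N → ℂ → ℂ} {x : ℂ}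
    (hx : wronskian f x ≠ 0) {c : Fin N → ℂ}
    (h : ∀ a, ∑ b : Fin N, c b * iteratedDeriv (b : ℕ) (f a) x = 0) : c = 0 := by
  refine Matrix.eq_zero_of_mulVec_eq_zero hx (v := c) ?_
  funext a
  rw [Pi.zero_apply, ← h a]
  simp [Matrix.mulVec, dotProduct, mul_comm]

theorem eq_zero_of_sum_mul_iteratedDeriv_row {N : ℕ} {f : Fin N → ℂ → ℂ} {x : ℂ}
    (hx : wronskian f x ≠ 0) {c : Fin N → ℂ}
    (h : ∀ b : Fin N, ∑ a, c a * iteratedDeriv (b : ℕ) (f a) x = 0) : c = 0 := by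
  refine Matrix.eq_zero_of_vecMul_eq_zero hx (v := c) ?_
  funext b
  rw [Pi.zero_apply, ← h b]
  simp [Matrix.vecMul, dotProduct]

/-- Pointwise uniqueness of the monic operator: the difference of two candidates has order below
`N`, and its coefficient vector is killed by the invertible Wronskian matrix. -/
theorem eq_opCoeff {N : ℕ} {f : Fin N → ℂ → ℂ} {x : ℂ} (hx : wronskian f x ≠ 0)
    {c : Fin (N + 1) → ℂ} (hc : c (Fin.last N) = 1)
    (h : ∀ a, ∑ k : Fin (N + 1), c k * iteratedDeriv (k : ℕ) (f a) x = 0) (k : Fin (N + 1)) :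
    opCoeff f k x = c k := by
  have h0 : (fun b : Fin N => c b.castSucc - opCoeff f b.castSucc x) = 0 := by
    refine eq_zero_of_sum_mul_iteratedDeriv hx fun a => ?_
    have h1 := h a
    have h2 := monicOp_self f a x
    rw [monicOp] at h2
    rw [Fin.sum_univ_castSucc] at h1 h2
    rw [hc] at h1
    rw [opCoeff_last hx] at h2
    simp only [sub_mul, Finset.sum_sub_distrib]
    simp only [Fin.val_castSucc] at h1 h2
    linear_combination h1 - h2
  induction k using Fin.lastCases with
  | last => rw [hc, opCoeff_last hx]
  | cast b => exact (sub_eq_zero.1 (congrFun h0 b)).symm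

theorem wronskian_sum_smul {N : ℕ} {f : Fin N → ℂ → ℂ} (hf : ∀ a, f a ∈ entire)
    (T : Matrix (Fin N) (Fin N) ℂ) (x : ℂ) :
    wronskian (fun i => ∑ a, T i a • f a) x = T.det * wronskian f x :=
  genWronskian_sum_smul hf T _ x

theorem opCoeff_sum_smul {N : ℕ} {f : Fin N → ℂ → ℂ} (hf : ∀ a, f a ∈ entire)
    {T : Matrix (Fin N) (Fin N) ℂ} (hT : T.det ≠ 0) (k : Fin (N + 1)) (x : ℂ) :
    opCoeff (fun i => ∑ a, T i a • f a) k x = opCoeff f k x := by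
  rw [opCoeff, opCoeff, wronskian_sum_smul hf, genWronskian_sum_smul hf, mul_left_comm,
    mul_div_mul_left _ _ hT]

theorem cramer_wronskian {N : ℕ} (f : Fin N → ℂ → ℂ) (g : ℂ → ℂ) {x : ℂ}
    (hx : wronskian f x ≠ 0) (b : Fin N) :
    ∑ a, wronskian (Function.update f a g) x / wronskian f x * iteratedDeriv (b : ℕ) (f a) x =
      iteratedDeriv (b : ℕ) g x := by
  set M : Matrix (Fin N) (Fin N) ℂ := Matrix.of fun a b : Fin N => iteratedDeriv (b : ℕ) (f a) x
    with hM
  have h := congrFun (Matrix.mulVec_cramer M.transpose fun b => iteratedDeriv (b : ℕ) g x) b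
  have h1 : ∀ a, M.transpose.cramer (fun b => iteratedDeriv (b : ℕ) g x) a =
      wronskian (Function.update f a g) x := fun a => by
    rw [Matrix.cramer_transpose_apply, wronskian, genWronskian]
    congr 1
    ext i j
    by_cases hi : i = a
    · subst hi
      simp
    · simp [hi, hM]
  have h2 : M.transpose.det = wronskian f x := Matrix.det_transpose M
  rw [h2] at h
  simp only [Matrix.mulVec, dotProduct, h1, Pi.smul_apply, smul_eq_mul] at h
  have h3 : iteratedDeriv (b : ℕ) g x =
      (∑ a, M.transpose b a * wronskian (Function.update f a g) x) / wronskian f x := by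
    rw [h]
    field_simp
  rw [h3, Finset.sum_div]
  exact Finset.sum_congr rfl fun a _ => by simp [hM]; ring

/-- Entire functions whose Wronskian vanishes identically are linearly dependent. -/
theorem exists_wronskian_ne_zero {N : ℕ} {f : Fin N → ℂ → ℂ} (hf : ∀ a, f a ∈ entire)
    (hind : LinearIndependent ℂ f) : ∃ x, wronskian f x ≠ 0 := by
  induction N with
  | zero => exact ⟨0, by simp [wronskian, genWronskian]⟩
  | succ N ih =>
    by_contra! hW
    set g : Fin N → ℂ → ℂ := fun a => f a.castSucc with hg
    have hge : ∀ a, g a ∈ entire := fun a => hf _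
    set y := f (Fin.last N) with hy
    have hye : y ∈ entire := hf _
    have hfg : f = (Fin.snoc g y : Fin (N + 1) → ℂ → ℂ) := (Fin.snoc_init_self f).symm
    obtain ⟨x₀, hx₀⟩ := ih hge (hind.comp _ (Fin.castSucc_injective N))
    have hopen : IsOpen {x | wronskian g x ≠ 0} :=
      isOpen_ne_fun (mem_entire.1 (wronskian_mem_entire hge)).continuous continuous_const
    obtain ⟨ε, hε, hball⟩ := Metric.isOpen_iff.1 hopen x₀ hx₀
    -- Near a point where `Wr(g)` does not vanish, Cramer's rule writes `y` as a combination of the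
    -- `g a` with variable coefficients, matching derivatives of orders below `N`.
    set c : Fin N → ℂ → ℂ := fun a x => wronskian (Function.update g a y) x / wronskian g x
      with hc
    have hcd : ∀ a, ∀ x ∈ Metric.ball x₀ ε, DifferentiableAt ℂ (c a) x := fun a x hx => by
      refine DifferentiableAt.div ?_ (wronskian_mem_entire hge x) (hball hx)
      refine wronskian_mem_entire (fun i => ?_) x
      by_cases hi : i = a
      · subst hi
        simpa using hye
      · simpa [hi] using hge i
    have hlow : ∀ x ∈ Metric.ball x₀ ε, ∀ b : Fin N,
        ∑ a, c a x * iteratedDeriv (b : ℕ) (g a) x = iteratedDeriv (b : ℕ) y x :=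
      fun x hx b => cramer_wronskian g y (hball hx) b
    -- The vanishing of the full Wronskian says that the monic operator of `g` kills `y`, which
    -- supplies the matching of the derivatives of order `N`.
    have htop : ∀ x ∈ Metric.ball x₀ ε,
        ∑ a, c a x * iteratedDeriv N (g a) x = iteratedDeriv N y x := fun x hx => by
      have h1 : monicOp g y x = 0 := by rw [monicOp_eq, ← hfg, hW, zero_div]
      have h2 : ∀ a, monicOp g (g a) x = 0 := fun a => monicOp_self g a x
      have h3 : ∑ a, c a x * monicOp g (g a) x - monicOp g y x =
          ∑ a, c a x * iteratedDeriv N (g a) x - iteratedDeriv N y x := by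
        simp only [monicOp, Fin.sum_univ_castSucc, opCoeff_last (hball hx), one_mul, mul_add,
          Finset.sum_add_distrib, Fin.val_castSucc, Fin.val_last]
        simp only [← hlow x hx, Finset.mul_sum]
        rw [Finset.sum_comm]
        have : ∀ b a, c a x * (opCoeff g (Fin.castSucc b) x * iteratedDeriv (b : ℕ) (g a) x) =
          opCoeff g (Fin.castSucc b) x * (c a x * iteratedDeriv (b : ℕ) (g a) x) :=
            fun b a => by ring
        simp only [this]
        ring
      rw [h1] at h3
      simp only [h2, mul_zero, Finset.sum_const_zero, sub_zero] at h3
      exact (sub_eq_zero.1 h3.symm)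
    have hall : ∀ x ∈ Metric.ball x₀ ε, ∀ b : ℕ, b ≤ N →
        ∑ a, c a x * iteratedDeriv b (g a) x = iteratedDeriv b y x := fun x hx b hb => by
      rcases hb.lt_or_eq with hb | rfl
      · exact hlow x hx ⟨b, hb⟩
      · exact htop x hx
    -- Differentiating the relation of order `b` and subtracting the one of order `b + 1` leaves `∑
    -- c_a' g_a⁽ᵇ⁾ = 0` for all `b < N`. Hence the coefficients are constant on the ball, and the
    -- relation extends to the plane by the identity theorem.
    have hderiv : ∀ x ∈ Metric.ball x₀ ε, (fun a => deriv (c a) x) = 0 := fun x hx => by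
      refine eq_zero_of_sum_mul_iteratedDeriv_row (hball hx) fun b => ?_
      have h1 : HasDerivAt (fun x => ∑ a, c a x * iteratedDeriv (b : ℕ) (g a) x)
          (∑ a, (deriv (c a) x * iteratedDeriv (b : ℕ) (g a) x +
            c a x * iteratedDeriv ((b : ℕ) + 1) (g a) x)) x :=
        HasDerivAt.fun_sum fun a _ =>
          (hcd a x hx).hasDerivAt.mul (hasDerivAt_iteratedDeriv (hge a) _ x)
      have h2 : (fun x => ∑ a, c a x * iteratedDeriv (b : ℕ) (g a) x) =ᶠ[𝓝 x]
          iteratedDeriv (b : ℕ) y := by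
        filter_upwards [Metric.isOpen_ball.mem_nhds hx] with x hx using hall x hx b b.2.le
      have h3 := (h1.congr_of_eventuallyEq h2.symm).unique (hasDerivAt_iteratedDeriv hye b x)
      rw [Finset.sum_add_distrib, hall x hx _ b.2] at h3
      simpa using h3
    have hconst : ∀ x ∈ Metric.ball x₀ ε, ∀ a, c a x = c a x₀ := fun x hx a =>
      Metric.isOpen_ball.is_const_of_deriv_eq_zero (convex_ball x₀ ε).isPreconnected
        (fun z hz => (hcd a z hz).differentiableWithinAt)
        (fun z hz => congrFun (hderiv z hz) a) hx (Metric.mem_ball_self hε)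
    have hu : y - ∑ a, c a x₀ • g a = 0 := by
      refine eq_zero_of_entire_of_eventuallyEq (z := x₀)
        (entire.sub_mem hye (entire.sum_mem fun a _ => entire.smul_mem _ (hge a))) ?_
      filter_upwards [mem_nhdsWithin_of_mem_nhds (Metric.ball_mem_nhds x₀ hε)] with x hx
      have := hall x hx 0 (Nat.zero_le _)
      simp only [iteratedDeriv_zero, hconst x hx] at this
      simp [← this]
    have hc0 := Fintype.linearIndependent_iff.1 hind (Fin.snoc (fun a => - c a x₀) 1) (by
      rw [Fin.sum_univ_castSucc]
      simp only [Fin.snoc_castSucc, Fin.snoc_last, one_smul, neg_smul, Finset.sum_neg_distrib]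
      rw [neg_add_eq_sub]
      exact hu) (Fin.last N)
    simp at hc0

/-! ### Factorization of the monic operator -/

theorem differentiableAt_opCoeff {N : ℕ} {f : Fin N → ℂ → ℂ} (hf : ∀ a, f a ∈ entire) {x : ℂ}
    (hx : wronskian f x ≠ 0) (k : Fin (N + 1)) : DifferentiableAt ℂ (opCoeff f k) x :=
  ((genWronskian_mem_entire hf _ x).const_mul _).div (wronskian_mem_entire hf x) hx

theorem isOpen_wronskian_ne_zero {N : ℕ} {f : Fin N → ℂ → ℂ} (hf : ∀ a, f a ∈ entire) :
    IsOpen {x | wronskian f x ≠ 0} :=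
  isOpen_ne_fun (mem_entire.1 (wronskian_mem_entire hf)).continuous continuous_const

theorem hasDerivAt_monicOp {N : ℕ} {f : Fin N → ℂ → ℂ} (hf : ∀ a, f a ∈ entire) {y : ℂ → ℂ}
    (hy : y ∈ entire) {x : ℂ} (hx : wronskian f x ≠ 0) :
    HasDerivAt (monicOp f y) (∑ k : Fin (N + 1), (deriv (opCoeff f k) x *
      iteratedDeriv (k : ℕ) y x + opCoeff f k x * iteratedDeriv ((k : ℕ) + 1) y x)) x :=
  HasDerivAt.fun_sum fun k _ => (differentiableAt_opCoeff hf hx k).hasDerivAt.mul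
    (hasDerivAt_iteratedDeriv hy _ x)

/-- The coefficients of `(∂ - h'/h) ∘ D`, where `D` is the monic operator annihilating
`f₁, …, f_N`. -/
noncomputable def stepCoeff {N : ℕ} (f : Fin N → ℂ → ℂ) (h : ℂ → ℂ) (k : Fin (N + 2)) : ℂ → ℂ :=
  (Fin.cons (0 : ℂ → ℂ) (opCoeff f) : Fin (N + 2) → ℂ → ℂ) k +
    (Fin.snoc (fun j => deriv (opCoeff f j) - logDeriv h * opCoeff f j) (0 : ℂ → ℂ) :
      Fin (N + 2) → ℂ → ℂ) k

theorem sum_stepCoeff {N : ℕ} {f : Fin N → ℂ → ℂ} (hf : ∀ a, f a ∈ entire) {y : ℂ → ℂ}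
    (hy : y ∈ entire) {x : ℂ} (hx : wronskian f x ≠ 0) (h : ℂ → ℂ) :
    ∑ k, stepCoeff f h k x * iteratedDeriv (k : ℕ) y x =
      deriv (monicOp f y) x - logDeriv h x * monicOp f y x := by
  rw [(hasDerivAt_monicOp hf hy hx).deriv]
  simp only [stepCoeff, Pi.add_apply, add_mul, Finset.sum_add_distrib]
  rw [Fin.sum_univ_succ, Fin.sum_univ_castSucc (n := N + 1)]
  simp only [Fin.cons_zero, Fin.cons_succ, Fin.snoc_castSucc, Fin.snoc_last, Pi.zero_apply,
    zero_mul, zero_add, add_zero, Fin.val_castSucc, Fin.val_succ, Pi.sub_apply, Pi.mul_apply,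
    sub_mul, Finset.sum_sub_distrib, monicOp, Finset.mul_sum]
  simp only [mul_assoc]
  ring

section Factorization

variable {N : ℕ} {f : Fin (N + 1) → ℂ → ℂ}

theorem monicOp_castSucc (f : Fin (N + 1) → ℂ → ℂ) (x : ℂ) :
    monicOp (fun a : Fin N => f a.castSucc) (f (Fin.last N)) x =
      wronskian f x / wronskian (fun a : Fin N => f a.castSucc) x := by
  rw [monicOp_eq]
  congr 2
  exact Fin.snoc_init_self f

/-- With `h = D_g f_{N+1}`, the operator `(∂ - h'/h) ∘ D_g` is monic, kills `f₁, …, f_N` because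
`D_g` does, and kills `f_{N+1}` because `∂ - h'/h` kills `h`. Uniqueness does the rest. -/
theorem opCoeff_eq_stepCoeff (hf : ∀ a, f a ∈ entire) {x : ℂ} (hx : wronskian f x ≠ 0)
    (hx' : wronskian (fun a : Fin N => f a.castSucc) x ≠ 0) (k : Fin (N + 2)) :
    opCoeff f k x = stepCoeff (fun a : Fin N => f a.castSucc)
      (monicOp (fun a : Fin N => f a.castSucc) (f (Fin.last N))) k x := by
  set g := fun a : Fin N => f a.castSucc with hg
  refine eq_opCoeff hx (c := fun k => stepCoeff g (monicOp g (f (Fin.last N))) k x) ?_ ?_ k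
  · simp only [stepCoeff, Pi.add_apply, Fin.snoc_last, Pi.zero_apply, add_zero]
    rw [← Fin.succ_last, Fin.cons_succ, opCoeff_last hx']
  · intro a
    rw [sum_stepCoeff (f := g) (fun a => hf _) (hf a) hx']
    induction a using Fin.lastCases with
    | last =>
      have h0 : monicOp g (f (Fin.last N)) x ≠ 0 := by
        rw [monicOp_castSucc f x]
        exact div_ne_zero hx hx'
      rw [logDeriv_apply, div_mul_cancel₀ _ h0, sub_self]
    | cast b =>
      have h0 : monicOp g (f b.castSucc) = fun _ => 0 := funext fun x => monicOp_self g b x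
      simp [h0]

theorem monicOp_eq_deriv_sub (hf : ∀ a, f a ∈ entire) {x : ℂ} (hx : wronskian f x ≠ 0)
    (hx' : wronskian (fun a : Fin N => f a.castSucc) x ≠ 0) {y : ℂ → ℂ} (hy : y ∈ entire) :
    monicOp f y x = deriv (monicOp (fun a : Fin N => f a.castSucc) y) x -
      logDeriv (monicOp (fun a : Fin N => f a.castSucc) (f (Fin.last N))) x *
        monicOp (fun a : Fin N => f a.castSucc) y x := by
  rw [← sum_stepCoeff (fun a => hf _) hy hx', monicOp]
  exact Finset.sum_congr rfl fun k _ => by rw [opCoeff_eq_stepCoeff hf hx hx']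

theorem differentiableAt_monicOp {N : ℕ} {f : Fin N → ℂ → ℂ} (hf : ∀ a, f a ∈ entire) {y : ℂ → ℂ}
    (hy : y ∈ entire) {x : ℂ} (hx : wronskian f x ≠ 0) : DifferentiableAt ℂ (monicOp f y) x :=
  (hasDerivAt_monicOp hf hy hx).differentiableAt

/-- The product of `Wr(f₁, …, f_N) / Wr(f₁, …, f_{N+1})` and `D y`, where `D` is the monic operator
annihilating `f₁, …, f_{N+1}`, is an exact derivative. -/
theorem hasDerivAt_wronskian_div (hf : ∀ a, f a ∈ entire)
    (hne : ∃ x, wronskian (fun a : Fin N => f a.castSucc) x ≠ 0) {y : ℂ → ℂ} (hy : y ∈ entire)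
    {x : ℂ} (hx : wronskian f x ≠ 0) :
    HasDerivAt (fun x => wronskian (Fin.snoc (fun a : Fin N => f a.castSucc) y :
      Fin (N + 1) → ℂ → ℂ) x / wronskian f x)
      (wronskian (fun a : Fin N => f a.castSucc) x / wronskian f x * monicOp f y x) x := by
  set g := fun a : Fin N => f a.castSucc with hg
  have hge : ∀ a, g a ∈ entire := fun a => hf _
  have hse : ∀ a, (Fin.snoc g y : Fin (N + 1) → ℂ → ℂ) a ∈ entire := fun a => by
    induction a using Fin.lastCases with
    | last => simpa using hy
    | cast b => simpa using hge b
  set K : ℂ → ℂ := fun x => wronskian (Fin.snoc g y : Fin (N + 1) → ℂ → ℂ) x / wronskian f x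
  have hKd : DifferentiableOn ℂ K {x | wronskian f x ≠ 0} := fun x hx =>
    ((wronskian_mem_entire hse x).div (wronskian_mem_entire hf x) hx).differentiableWithinAt
  have hnhds : {x | wronskian f x ≠ 0} ∈ 𝓝 x := (isOpen_wronskian_ne_zero hf).mem_nhds hx
  have hKx : DifferentiableAt ℂ K x := hKd.differentiableAt hnhds
  have hK' : ContinuousAt (deriv K) x :=
    ((hKd.deriv (isOpen_wronskian_ne_zero hf)).differentiableAt hnhds).continuousAt
  have hR : ContinuousAt (fun x => wronskian g x / wronskian f x * monicOp f y x) x :=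
    (((wronskian_mem_entire hge x).div (wronskian_mem_entire hf x) hx).mul
      (differentiableAt_monicOp hf hy hx)).continuousAt
  -- Where `Wr(g) ≠ 0`, `K = D_g y / h` and `Wr(g)/Wr(f) = 1/h`, so the claim is the quotient rule
  -- together with the factorization. Zeros of `Wr(g)` are isolated, and continuity of both sides
  -- then reaches `x` itself.
  have heq : deriv K =ᶠ[𝓝[≠] x] fun x => wronskian g x / wronskian f x * monicOp f y x := by
    filter_upwards [mem_nhdsWithin_of_mem_nhds hnhds,
      eventually_ne_zero_of_entire (wronskian_mem_entire hge) hne x] with z hz hz'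
    have hh0 : monicOp g (f (Fin.last N)) z ≠ 0 := by
      rw [monicOp_castSucc f z]
      exact div_ne_zero hz hz'
    have h1 : K =ᶠ[𝓝 z] fun z => monicOp g y z / monicOp g (f (Fin.last N)) z := by
      filter_upwards [(isOpen_wronskian_ne_zero hge).mem_nhds hz'] with w hw
      rw [monicOp_castSucc f w, monicOp_eq]
      exact (div_div_div_cancel_right₀ hw _ _).symm
    have e : monicOp f y z = deriv (monicOp g y) z -
        logDeriv (monicOp g (f (Fin.last N))) z * monicOp g y z :=
      monicOp_eq_deriv_sub hf hz hz' hy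
    rw [h1.deriv_eq, deriv_fun_div (differentiableAt_monicOp hge hy hz')
      (differentiableAt_monicOp hge (hf _) hz') hh0, e, logDeriv_apply]
    have h2 : wronskian g z / wronskian f z = (monicOp g (f (Fin.last N)) z)⁻¹ := by
      rw [monicOp_castSucc f z, inv_div]
    rw [h2]
    field_simp
  have := ((hK'.eventuallyEq_nhds_iff_eventuallyEq_nhdsNE hR).1 heq).eq_of_nhds
  rw [← this]
  exact hKx.hasDerivAt

end Factorization

/-! ### Pole orders -/

theorem meromorphicAt_of_entire {f : ℂ → ℂ} (hf : f ∈ entire) (z : ℂ) : MeromorphicAt f z :=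
  ((mem_entire.1 hf).analyticAt z).meromorphicAt

/-- A derivative deepens a pole by one and keeps a holomorphic function holomorphic. The restriction
`s ≤ 0` lets the second case be absorbed in the bound. -/
theorem le_meromorphicOrderAt_deriv {b : ℂ → ℂ} {z : ℂ} (hb : MeromorphicAt b z) {s : ℤ}
    (hs : s ≤ 0) (h : (s : WithTop ℤ) ≤ meromorphicOrderAt b z) :
    ((s - 1 : ℤ) : WithTop ℤ) ≤ meromorphicOrderAt (deriv b) z := by
  by_cases h0 : 0 ≤ meromorphicOrderAt b z
  · obtain ⟨g, hg, hbg⟩ := hb.meromorphicOrderAt_nonneg_iff.1 h0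
    rw [meromorphicOrderAt_congr hbg.nhdsNE_deriv]
    refine le_trans ?_ hg.deriv.meromorphicOrderAt_nonneg
    exact_mod_cast (by omega : s - 1 ≤ 0)
  · have htop : meromorphicOrderAt b z ≠ ⊤ := fun ht => h0 (ht ▸ le_top)
    lift meromorphicOrderAt b z to ℤ using htop with n hn
    have hn0 : n ≠ 0 := fun h => h0 (by simp [h])
    rw [meromorphicOrderAt_deriv_eq_sub_one (by exact_mod_cast hn0) hn.symm]
    have : s ≤ n := by exact_mod_cast h
    exact_mod_cast (by omega : s - 1 ≤ n - 1)

theorem neg_one_le_meromorphicOrderAt_logDeriv {h : ℂ → ℂ} {z : ℂ} (hh : MeromorphicAt h z)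
    (htop : meromorphicOrderAt h z ≠ ⊤) :
    ((-1 : ℤ) : WithTop ℤ) ≤ meromorphicOrderAt (logDeriv h) z := by
  by_cases h0 : meromorphicOrderAt h z = 0
  · refine le_trans ?_ (meromorphicOrderAt_logDeriv_nonneg hh h0)
    exact_mod_cast (by omega : (-1 : ℤ) ≤ 0)
  · rw [meromorphicOrderAt_logDeriv_eq_neg_one hh h0 htop]
    rfl

theorem le_meromorphicOrderAt_add {a b : ℂ → ℂ} {z : ℂ} {s : WithTop ℤ} (ha : MeromorphicAt a z)
    (hb : MeromorphicAt b z) (h1 : s ≤ meromorphicOrderAt a z) (h2 : s ≤ meromorphicOrderAt b z) :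
    s ≤ meromorphicOrderAt (a + b) z :=
  (le_min h1 h2).trans (meromorphicOrderAt_add ha hb)

theorem le_meromorphicOrderAt_mul {a b : ℂ → ℂ} {z : ℂ} {s t : ℤ} (ha : MeromorphicAt a z)
    (hb : MeromorphicAt b z) (h1 : (s : WithTop ℤ) ≤ meromorphicOrderAt a z)
    (h2 : (t : WithTop ℤ) ≤ meromorphicOrderAt b z) :
    ((s + t : ℤ) : WithTop ℤ) ≤ meromorphicOrderAt (a * b) z := by
  rw [meromorphicOrderAt_mul ha hb, WithTop.coe_add]
  exact add_le_add h1 h2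

theorem meromorphicAt_opCoeff {N : ℕ} {f : Fin N → ℂ → ℂ} (hf : ∀ a, f a ∈ entire)
    (k : Fin (N + 1)) (z : ℂ) : MeromorphicAt (opCoeff f k) z :=
  ((MeromorphicAt.const _ z).mul (meromorphicAt_of_entire (genWronskian_mem_entire hf _) z)).div
    (meromorphicAt_of_entire (wronskian_mem_entire hf) z)

theorem meromorphicAt_wronskian_div {N M : ℕ} {f : Fin N → ℂ → ℂ} {g : Fin M → ℂ → ℂ}
    (hf : ∀ a, f a ∈ entire) (hg : ∀ a, g a ∈ entire) (z : ℂ) :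
    MeromorphicAt (fun x => wronskian f x / wronskian g x) z :=
  (meromorphicAt_of_entire (wronskian_mem_entire hf) z).div
    (meromorphicAt_of_entire (wronskian_mem_entire hg) z)

theorem monicOp_eq_wronskian_div {N : ℕ} (f : Fin (N + 1) → ℂ → ℂ) :
    monicOp (fun a : Fin N => f a.castSucc) (f (Fin.last N)) =
      fun x => wronskian f x / wronskian (fun a : Fin N => f a.castSucc) x :=
  funext fun x => monicOp_castSucc f x

theorem eventually_wronskian_div_ne_zero {N M : ℕ} {f : Fin N → ℂ → ℂ} {g : Fin M → ℂ → ℂ}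
    (hf : ∀ a, f a ∈ entire) (hg : ∀ a, g a ∈ entire) (hf' : LinearIndependent ℂ f)
    (hg' : LinearIndependent ℂ g) (z : ℂ) :
    ∀ᶠ x in 𝓝[≠] z, wronskian f x / wronskian g x ≠ 0 := by
  filter_upwards [eventually_ne_zero_of_entire (wronskian_mem_entire hf)
    (exists_wronskian_ne_zero hf hf') z, eventually_ne_zero_of_entire (wronskian_mem_entire hg)
    (exists_wronskian_ne_zero hg hg') z] with x h1 h2 using div_ne_zero h1 h2

/-- The monic operator annihilating independent entire functions is Fuchsian. -/
theorem le_meromorphicOrderAt_opCoeff {N : ℕ} {f : Fin N → ℂ → ℂ} (hf : ∀ a, f a ∈ entire)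
    (hind : LinearIndependent ℂ f) (z : ℂ) (k : Fin (N + 1)) :
    (((k : ℕ) - N : ℤ) : WithTop ℤ) ≤ meromorphicOrderAt (opCoeff f k) z := by
  -- With `c_k` the coefficients of the smaller operator, the new ones are `c_{k-1} + c_k' - (h'/h)
  -- c_k`, and `h'/h` has at most a simple pole. Each term therefore has order at least `k - (N +
  -- 1)`.
  induction N with
  | zero =>
    obtain rfl : k = Fin.last 0 := Fin.ext (by simp)
    have : opCoeff f (Fin.last 0) = fun _ => 1 := by
      funext x
      rw [opCoeff_last]
      simp [wronskian, genWronskian]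
    rw [this, meromorphicOrderAt_const, if_neg one_ne_zero]
    simp
  | succ N ih =>
    set g := fun a : Fin N => f a.castSucc with hg
    have hge : ∀ a, g a ∈ entire := fun a => hf _
    have hgi : LinearIndependent ℂ g := hind.comp _ (Fin.castSucc_injective N)
    set h := monicOp g (f (Fin.last N)) with hh
    have hhm : MeromorphicAt h z := by
      rw [hh, monicOp_eq_wronskian_div]
      exact meromorphicAt_wronskian_div hf hge z
    have hhtop : meromorphicOrderAt h z ≠ ⊤ := by
      rw [meromorphicOrderAt_ne_top_iff_eventually_ne_zero hhm, hh, monicOp_eq_wronskian_div]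
      exact eventually_wronskian_div_ne_zero hf hge hind hgi z
    have hlogm : MeromorphicAt (logDeriv h) z := hhm.deriv.div hhm
    have heq : opCoeff f k =ᶠ[𝓝[≠] z] stepCoeff g h k := by
      filter_upwards [eventually_ne_zero_of_entire (wronskian_mem_entire hf)
        (exists_wronskian_ne_zero hf hind) z, eventually_ne_zero_of_entire
        (wronskian_mem_entire hge) (exists_wronskian_ne_zero hge hgi) z] with x h1 h2
      exact opCoeff_eq_stepCoeff hf h1 h2 k
    rw [meromorphicOrderAt_congr heq, stepCoeff]
    have hA : MeromorphicAt ((Fin.cons (0 : ℂ → ℂ) (opCoeff g) : Fin (N + 2) → ℂ → ℂ) k) z ∧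
        (((k : ℕ) - (N + 1 : ℕ) : ℤ) : WithTop ℤ) ≤
          meromorphicOrderAt ((Fin.cons (0 : ℂ → ℂ) (opCoeff g) : Fin (N + 2) → ℂ → ℂ) k) z := by
      induction k using Fin.cases with
      | zero =>
        rw [Fin.cons_zero, (meromorphicOrderAt_eq_top_iff (f := (0 : ℂ → ℂ))).2
          (Eventually.of_forall fun _ => rfl)]
        exact ⟨MeromorphicAt.const 0 z, le_top⟩
      | succ j =>
        rw [Fin.cons_succ]
        refine ⟨meromorphicAt_opCoeff hge j z, le_trans (le_of_eq ?_) (ih hge hgi j)⟩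
        congr 1
        rw [Fin.val_succ]
        push_cast
        ring
    have hB : MeromorphicAt ((Fin.snoc (fun j => deriv (opCoeff g j) - logDeriv h * opCoeff g j)
        (0 : ℂ → ℂ) : Fin (N + 2) → ℂ → ℂ) k) z ∧
        (((k : ℕ) - (N + 1 : ℕ) : ℤ) : WithTop ℤ) ≤
          meromorphicOrderAt ((Fin.snoc (fun j => deriv (opCoeff g j) - logDeriv h * opCoeff g j)
        (0 : ℂ → ℂ) : Fin (N + 2) → ℂ → ℂ) k) z := by
      induction k using Fin.lastCases with
      | last =>
        rw [Fin.snoc_last, (meromorphicOrderAt_eq_top_iff (f := (0 : ℂ → ℂ))).2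
          (Eventually.of_forall fun _ => rfl)]
        exact ⟨MeromorphicAt.const 0 z, le_top⟩
      | cast j =>
        rw [Fin.snoc_castSucc]
        have hj := meromorphicAt_opCoeff hge j z
        have hjo := ih hge hgi j
        have hjN : (j : ℕ) ≤ N := Nat.lt_succ_iff.1 j.2
        refine ⟨hj.deriv.sub (hlogm.mul hj), ?_⟩
        rw [sub_eq_add_neg (deriv (opCoeff g j))]
        have e1 : ((Fin.castSucc j : ℕ) - (N + 1 : ℕ) : ℤ) = ((j : ℕ) - N : ℤ) - 1 := by
          rw [Fin.val_castSucc]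
          push_cast
          ring
        have e2 : ((Fin.castSucc j : ℕ) - (N + 1 : ℕ) : ℤ) = -1 + ((j : ℕ) - N : ℤ) := by
          rw [e1]
          ring
        refine le_meromorphicOrderAt_add hj.deriv (hlogm.mul hj).neg ?_ ?_
        · rw [e1]
          exact le_meromorphicOrderAt_deriv hj (by omega) hjo
        · rw [← meromorphicOrderAt_neg, e2]
          exact le_meromorphicOrderAt_mul hlogm hj
            (neg_one_le_meromorphicOrderAt_logDeriv hhm hhtop) hjo
    exact le_meromorphicOrderAt_add hA.1 hB.1 hA.2 hB.2

/-! ### The conjugate space -/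

/-- The Wronskian matrix of a family of functions. -/
noncomputable def wronskianMatrix {N : ℕ} (f : Fin N → ℂ → ℂ) (x : ℂ) : Matrix (Fin N) (Fin N) ℂ :=
  Matrix.of fun a b : Fin N => iteratedDeriv (b : ℕ) (f a) x

/-- The last row of the inverse of the Wronskian matrix. -/
noncomputable def dualFun {m : ℕ} (f : Fin (m + 1) → ℂ → ℂ) (a : Fin (m + 1)) (x : ℂ) : ℂ :=
  (wronskianMatrix f x)⁻¹ (Fin.last m) a

theorem dualFun_eq {m : ℕ} (f : Fin (m + 1) → ℂ → ℂ) (a : Fin (m + 1)) (x : ℂ) :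
    dualFun f a x = (-1) ^ ((a : ℕ) + m) * (wronskian (fun i => f (a.succAbove i)) x /
      wronskian f x) := by
  rw [dualFun, Matrix.inv_def, Matrix.smul_apply, Matrix.adjugate_fin_succ_eq_det_submatrix,
    Ring.inverse_eq_inv', smul_eq_mul]
  have : (wronskianMatrix f x).submatrix a.succAbove (Fin.last m).succAbove =
      Matrix.of fun i b : Fin m => iteratedDeriv (b : ℕ) (f (a.succAbove i)) x := by
    ext i b
    simp [wronskianMatrix]
  rw [this]
  simp only [wronskian, genWronskian, wronskianMatrix, Fin.val_last]
  ring

theorem wronskianMatrix_sum_smul {N : ℕ} {f : Fin N → ℂ → ℂ} (hf : ∀ a, f a ∈ entire)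
    (T : Matrix (Fin N) (Fin N) ℂ) (x : ℂ) :
    wronskianMatrix (fun i => ∑ a, T i a • f a) x = T * wronskianMatrix f x := by
  ext i b
  simp [wronskianMatrix, Matrix.mul_apply, iteratedDeriv_sum_smul _ _ _ hf]

/-- Append to `S` the last row of `M⁻¹`, where `M` is the Wronskian matrix, and multiply by `M`: the
last row becomes a unit vector, and its complementary minor is the Wronskian of the combinations.
Expanding the determinant of the bordered matrix gives the sum. -/
theorem wronskian_div_eq_sum_dualFun {m : ℕ} {f : Fin (m + 1) → ℂ → ℂ} (hf : ∀ a, f a ∈ entire)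
    (S : Fin m → Fin (m + 1) → ℂ) (x : ℂ) :
    wronskian (fun i => ∑ a, S i a • f a) x / wronskian f x =
      ∑ a : Fin (m + 1), (-1) ^ (m + (a : ℕ)) *
        (Matrix.of fun i j : Fin m => S i (a.succAbove j)).det * dualFun f a x := by
  set M := wronskianMatrix f x with hM
  -- At a zero of the Wronskian both sides are `0` by the conventions for division by zero and for
  -- the inverse of a singular matrix.
  by_cases hx : wronskian f x = 0
  · have hdet : ¬ IsUnit M.det := by
      rw [isUnit_iff_ne_zero, not_not]
      exact hx
    simp [hx, dualFun, ← hM, Matrix.nonsing_inv_apply_not_isUnit _ hdet]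
  · have hdet : IsUnit M.det := isUnit_iff_ne_zero.2 hx
    set A : Matrix (Fin (m + 1)) (Fin (m + 1)) ℂ :=
      Matrix.of (Fin.snoc S (fun a => dualFun f a x) : Fin (m + 1) → Fin (m + 1) → ℂ) with hA
    have h1 : A.det = ∑ a : Fin (m + 1), (-1) ^ (m + (a : ℕ)) *
        (Matrix.of fun i j : Fin m => S i (a.succAbove j)).det * dualFun f a x := by
      rw [Matrix.det_succ_row A (Fin.last m)]
      refine Finset.sum_congr rfl fun a _ => ?_
      have : A.submatrix (Fin.last m).succAbove a.succAbove =
          Matrix.of fun i j : Fin m => S i (a.succAbove j) := by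
        ext i j
        simp [hA]
      rw [this]
      simp [hA]
      ring
    have hrow : ∀ b, (A * M) (Fin.last m) b = if b = Fin.last m then 1 else 0 := fun b => by
      have : (A * M) (Fin.last m) b = (M⁻¹ * M) (Fin.last m) b := by
        simp [Matrix.mul_apply, hA, dualFun, ← hM]
      rw [this, Matrix.nonsing_inv_mul _ hdet, Matrix.one_apply]
      simp [eq_comm]
    have h2 : (A * M).det = wronskian (fun i => ∑ a, S i a • f a) x := by
      rw [Matrix.det_succ_row _ (Fin.last m), Finset.sum_eq_single (Fin.last m)]
      · rw [hrow, if_pos rfl, wronskian, genWronskian]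
        have : (A * M).submatrix (Fin.last m).succAbove (Fin.last m).succAbove =
            Matrix.of fun i b : Fin m => iteratedDeriv (b : ℕ) (∑ a, S i a • f a) x := by
          ext i b
          simp [Matrix.mul_apply, hA, hM, wronskianMatrix, iteratedDeriv_sum_smul _ _ _ hf]
        rw [this]
        simp [← two_mul, pow_mul]
      · intro b _ hb
        rw [hrow, if_neg hb]
        simp
      · simp
    rw [← h1, ← h2, Matrix.det_mul, mul_div_assoc, show wronskian f x = M.det from rfl,
      div_self hdet.ne_zero, mul_one]

theorem exists_matrix_mulVec_eq_single {m : ℕ} {c : Fin (m + 1) → ℂ} (hc : c ≠ 0) :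
    ∃ T : Matrix (Fin (m + 1)) (Fin (m + 1)) ℂ, T.det ≠ 0 ∧
      T.mulVec c = Pi.single (Fin.last m) 1 := by
  obtain ⟨A, hA⟩ := SeparatingDual.exists_continuousLinearEquiv_apply_eq (R := ℂ) hc
    (y := Pi.single (Fin.last m) 1) (by simp)
  refine ⟨LinearMap.toMatrix' (A.toLinearEquiv : (Fin (m + 1) → ℂ) →ₗ[ℂ] Fin (m + 1) → ℂ), ?_, ?_⟩
  · rw [LinearMap.det_toMatrix']
    exact (LinearEquiv.isUnit_det' A.toLinearEquiv).ne_zero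
  · rw [LinearMap.toMatrix'_mulVec]
    exact hA

/-- Choose `T` invertible with `T c = e_last`. In the basis `T f` the inverse Wronskian matrix is
`M⁻¹ T⁻¹`, whose last column is `M⁻¹ c`. So every nonzero combination becomes a single quotient of
Wronskians, the form required for the exactness and order statements. -/
theorem exists_sum_dualFun_eq {m : ℕ} {f : Fin (m + 1) → ℂ → ℂ} (hf : ∀ a, f a ∈ entire)
    {c : Fin (m + 1) → ℂ} (hc : c ≠ 0) :
    ∃ T : Matrix (Fin (m + 1)) (Fin (m + 1)) ℂ, T.det ≠ 0 ∧
      (fun x => ∑ a, c a * dualFun f a x) = fun x =>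
        wronskian (fun i : Fin m => ∑ a, T i.castSucc a • f a) x /
          wronskian (fun i => ∑ a, T i a • f a) x := by
  obtain ⟨T, hT, hTc⟩ := exists_matrix_mulVec_eq_single hc
  refine ⟨T, hT, funext fun x => ?_⟩
  have h1 := dualFun_eq (fun i => ∑ a, T i a • f a) (Fin.last m) x
  simp only [Fin.val_last, ← two_mul, pow_mul, Fin.succAbove_last] at h1
  rw [neg_one_sq, one_pow, one_mul] at h1
  rw [← h1, dualFun, wronskianMatrix_sum_smul hf, Matrix.mul_inv_rev]
  have h2 : ((wronskianMatrix f x)⁻¹ * T⁻¹).mulVec (T.mulVec c) =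
      (wronskianMatrix f x)⁻¹.mulVec c := by
    rw [Matrix.mulVec_mulVec, Matrix.mul_assoc,
      Matrix.nonsing_inv_mul _ (isUnit_iff_ne_zero.2 hT), Matrix.mul_one]
  rw [hTc, Matrix.mulVec_single_one] at h2
  have h3 := congrFun h2 (Fin.last m)
  rw [Matrix.col_apply] at h3
  rw [h3, Matrix.mulVec, dotProduct]
  exact Finset.sum_congr rfl fun a _ => mul_comm _ _

/-! ### Bases of spaces of entire functions -/

section Basis

variable {V : Submodule ℂ (ℂ → ℂ)} [FiniteDimensional ℂ V]

theorem basisOf_eq : basisOf V = fun i => ((Module.finBasis ℂ V i : V) : ℂ → ℂ) := by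
  rw [basisOf, dif_pos ‹_›]

theorem basisOf_mem (i : Fin (Module.finrank ℂ V)) : basisOf V i ∈ V := by
  rw [basisOf_eq]
  exact (Module.finBasis ℂ V i).2

theorem basisOf_linearIndependent : LinearIndependent ℂ (basisOf V) := by
  rw [basisOf_eq]
  exact (Module.finBasis ℂ V).linearIndependent.map' V.subtype (Submodule.ker_subtype V)

theorem exists_sum_basisOf_eq {f : ℂ → ℂ} (hf : f ∈ V) :
    ∃ c : Fin (Module.finrank ℂ V) → ℂ, ∑ a, c a • basisOf V a = f := by
  refine ⟨fun a => (Module.finBasis ℂ V).repr ⟨f, hf⟩ a, ?_⟩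
  have := congrArg Subtype.val ((Module.finBasis ℂ V).sum_repr ⟨f, hf⟩)
  rw [Submodule.coe_sum] at this
  rw [basisOf_eq]
  exact this

end Basis

/-- A basis of `V` indexed by `Fin N`. -/
structure IsFamilyBasis {N : ℕ} (V : Submodule ℂ (ℂ → ℂ)) (f : Fin N → ℂ → ℂ) : Prop where
  mem_entire : ∀ a, f a ∈ entire
  linearIndependent : LinearIndependent ℂ f
  span_eq : Submodule.span ℂ (Set.range f) = V

theorem isFamilyBasis_basisOf {V : Submodule ℂ (ℂ → ℂ)} [FiniteDimensional ℂ V]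
    (hV : V ≤ entire) : IsFamilyBasis V (basisOf V) where
  mem_entire a := hV (basisOf_mem a)
  linearIndependent := basisOf_linearIndependent
  span_eq := le_antisymm (Submodule.span_le.2 (by
    rintro _ ⟨a, rfl⟩
    exact basisOf_mem a)) fun f hf => by
      rw [Submodule.mem_span_range_iff_exists_fun]
      exact exists_sum_basisOf_eq hf

theorem IsHomogeneousBasis.isFamilyBasis {N : ℕ} {V : Submodule ℂ (ℂ → ℂ)} {l : Fin N → ℂ}
    {p : Fin N → ℂ[X]} (h : IsHomogeneousBasis V l p) :
    IsFamilyBasis V fun a => expPoly (l a) (p a) where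
  mem_entire _ := expPoly_mem_entire _ _
  linearIndependent := h.linearIndependent
  span_eq := h.span_eq

namespace IsFamilyBasis

variable {N : ℕ} {V : Submodule ℂ (ℂ → ℂ)} {f : Fin N → ℂ → ℂ}

theorem mem (h : IsFamilyBasis V f) (a : Fin N) : f a ∈ V := by
  rw [← h.span_eq]
  exact Submodule.subset_span ⟨a, rfl⟩

theorem mem_iff (h : IsFamilyBasis V f) {y : ℂ → ℂ} : y ∈ V ↔ ∃ c : Fin N → ℂ, ∑ a, c a • f a = y := by
  rw [← h.span_eq, Submodule.mem_span_range_iff_exists_fun]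

theorem finiteDimensional (h : IsFamilyBasis V f) : FiniteDimensional ℂ V := by
  rw [← h.span_eq]
  exact FiniteDimensional.span_of_finite ℂ (Set.finite_range _)

theorem finrank_eq (h : IsFamilyBasis V f) : Module.finrank ℂ V = N := by
  rw [← h.span_eq, finrank_span_eq_card h.linearIndependent, Fintype.card_fin]

theorem le_entire (h : IsFamilyBasis V f) : V ≤ entire := by
  rw [← h.span_eq, Submodule.span_le]
  rintro _ ⟨a, rfl⟩
  exact h.mem_entire a

theorem exists_wronskian_ne_zero (h : IsFamilyBasis V f) : ∃ x, wronskian f x ≠ 0 :=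
  Bispectral.exists_wronskian_ne_zero h.mem_entire h.linearIndependent

theorem exists_matrix {g : Fin N → ℂ → ℂ} (h : IsFamilyBasis V f) (hg : IsFamilyBasis V g) :
    ∃ T : Matrix (Fin N) (Fin N) ℂ, T.det ≠ 0 ∧ g = fun i => ∑ a, T i a • f a := by
  have hmem : ∀ i, ∃ c : Fin N → ℂ, ∑ a, c a • f a = g i := fun i => h.mem_iff.1 (hg.mem i)
  choose T hT using hmem
  have hgT : g = fun i => ∑ a, (Matrix.of T) i a • f a := funext fun i => (hT i).symm
  refine ⟨Matrix.of T, fun h0 => ?_, hgT⟩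
  obtain ⟨x, hx⟩ := hg.exists_wronskian_ne_zero
  rw [hgT, wronskian_sum_smul h.mem_entire, h0, zero_mul] at hx
  exact hx rfl

theorem sum_smul (h : IsFamilyBasis V f) {T : Matrix (Fin N) (Fin N) ℂ} (hT : T.det ≠ 0) :
    IsFamilyBasis V fun i => ∑ a, T i a • f a := by
  have hmem : ∀ i, ∑ a, T i a • f a ∈ V := fun i => h.mem_iff.2 ⟨_, rfl⟩
  have hind : LinearIndependent ℂ fun i => ∑ a, T i a • f a := by
    rw [Fintype.linearIndependent_iff]
    intro c hc
    have h1 : ∑ a, (Matrix.vecMul c T) a • f a = 0 := by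
      rw [← hc]
      simp only [Matrix.vecMul, dotProduct, Finset.sum_smul, Finset.smul_sum, smul_smul]
      exact Finset.sum_comm
    have h2 : Matrix.vecMul c T = 0 := funext (Fintype.linearIndependent_iff.1 h.linearIndependent _ h1)
    exact congrFun (Matrix.eq_zero_of_vecMul_eq_zero hT h2)
  have := h.finiteDimensional
  refine ⟨fun i => h.le_entire (hmem i), hind, ?_⟩
  refine Submodule.eq_of_le_of_finrank_eq (Submodule.span_le.2 ?_) ?_
  · rintro _ ⟨i, rfl⟩
    exact hmem i
  · rw [finrank_span_eq_card hind, Fintype.card_fin, h.finrank_eq]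

theorem opCoeff_eq {g : Fin N → ℂ → ℂ} (h : IsFamilyBasis V f) (hg : IsFamilyBasis V g)
    (k : Fin (N + 1)) : opCoeff g k = opCoeff f k := by
  obtain ⟨T, hT, rfl⟩ := h.exists_matrix hg
  exact funext fun x => opCoeff_sum_smul h.mem_entire hT k x

theorem monicOperator_eq (h : IsFamilyBasis V f) : monicOperator V = monicOp f := by
  have := h.finiteDimensional
  obtain rfl := h.finrank_eq
  funext y x
  rw [monicOperator, monicOp]
  exact Finset.sum_congr rfl fun k _ => by
    rw [← h.opCoeff_eq (isFamilyBasis_basisOf h.le_entire)]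
    rfl

theorem conjugateSpace_eq {m : ℕ} {f : Fin (m + 1) → ℂ → ℂ} (h : IsFamilyBasis V f) :
    conjugateSpace V = Submodule.span ℂ (Set.range (dualFun f)) := by
  have := h.finiteDimensional
  have hm := h.finrank_eq
  obtain ⟨d, hd, hwr⟩ : ∃ d : ℂ, d ≠ 0 ∧ ∀ x, wronskianOf V x = d * wronskian f x := by
    have hb := isFamilyBasis_basisOf h.le_entire
    -- The length is generalized so that the equation `n = m + 1` can be substituted into the index
    -- type.
    have key : ∀ (n : ℕ) (g : Fin n → ℂ → ℂ), n = m + 1 → IsFamilyBasis V g →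
        ∃ d : ℂ, d ≠ 0 ∧ ∀ x, wronskian g x = d * wronskian f x := by
      rintro _ g rfl hg
      obtain ⟨T, hT, rfl⟩ := h.exists_matrix hg
      exact ⟨T.det, hT, fun x => wronskian_sum_smul h.mem_entire T x⟩
    exact key _ _ hm hb
  have hset : {g | ∃ φ : Fin (Module.finrank ℂ V - 1) → ℂ → ℂ, (∀ i, φ i ∈ V) ∧
      g = fun x => wronskian φ x / wronskianOf V x} = {g | ∃ φ : Fin m → ℂ → ℂ, (∀ i, φ i ∈ V) ∧
      g = fun x => wronskian φ x / wronskianOf V x} := by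
    obtain rfl : m = Module.finrank ℂ V - 1 := by omega
    rfl
  rw [conjugateSpace, hset]
  refine le_antisymm (Submodule.span_le.2 ?_) (Submodule.span_le.2 ?_)
  · rintro _ ⟨φ, hφ, rfl⟩
    choose S hS using fun i => h.mem_iff.1 (hφ i)
    have hφS : φ = fun i => ∑ a, S i a • f a := funext fun i => (hS i).symm
    refine (Submodule.mem_span_range_iff_exists_fun ℂ).2 ⟨fun a => d⁻¹ * ((-1) ^ (m + (a : ℕ)) *
        (Matrix.of fun i j : Fin m => S i (a.succAbove j)).det), funext fun x => ?_⟩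
    rw [hwr, div_mul_eq_div_div_swap, hφS, wronskian_div_eq_sum_dualFun h.mem_entire,
      div_eq_inv_mul, Finset.mul_sum]
    simp [mul_assoc]
  · rintro _ ⟨a, rfl⟩
    have : dualFun f a = ((-1) ^ ((a : ℕ) + m) * d) •
        fun x => wronskian (fun i => f (a.succAbove i)) x / wronskianOf V x := by
      funext x
      rw [dualFun_eq, Pi.smul_apply, smul_eq_mul, hwr]
      field_simp
    rw [this]
    exact Submodule.smul_mem _ _ (Submodule.subset_span ⟨_, fun i => h.mem _, rfl⟩)

/-- Every nonzero element of the conjugate space is a quotient of Wronskians of a suitable basis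
of `V`. -/
theorem exists_eq_wronskian_div {m : ℕ} {f : Fin (m + 1) → ℂ → ℂ} (h : IsFamilyBasis V f)
    {c : Fin (m + 1) → ℂ} (hc : c ≠ 0) : ∃ f' : Fin (m + 1) → ℂ → ℂ, IsFamilyBasis V f' ∧
      ∑ a, c a • dualFun f a =
        fun x => wronskian (fun i : Fin m => f' i.castSucc) x / wronskian f' x := by
  obtain ⟨T, hT, hc⟩ := exists_sum_dualFun_eq h.mem_entire hc
  refine ⟨_, h.sum_smul hT, ?_⟩
  rw [← hc]
  funext x
  simp

theorem exists_eq_wronskian_div_of_mem {m : ℕ} {f : Fin (m + 1) → ℂ → ℂ} (h : IsFamilyBasis V f)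
    {g : ℂ → ℂ} (hg : g ∈ conjugateSpace V) (hg0 : g ≠ 0) :
    ∃ f' : Fin (m + 1) → ℂ → ℂ, IsFamilyBasis V f' ∧
      g = fun x => wronskian (fun i : Fin m => f' i.castSucc) x / wronskian f' x := by
  rw [h.conjugateSpace_eq, Submodule.mem_span_range_iff_exists_fun] at hg
  obtain ⟨c, rfl⟩ := hg
  exact h.exists_eq_wronskian_div fun hc => hg0 (by simp [hc])

theorem castSucc_linearIndependent {m : ℕ} {f : Fin (m + 1) → ℂ → ℂ} (h : IsFamilyBasis V f) :
    LinearIndependent ℂ fun i : Fin m => f i.castSucc :=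
  h.linearIndependent.comp _ (Fin.castSucc_injective m)

/-- A nontrivial combination of the spanning functions is a quotient of Wronskians of independent
families, so it is not identically zero. -/
theorem finrank_conjugateSpace {m : ℕ} {f : Fin (m + 1) → ℂ → ℂ} (h : IsFamilyBasis V f) :
    Module.finrank ℂ (conjugateSpace V) = m + 1 := by
  have hind : LinearIndependent ℂ (dualFun f) := by
    by_contra hcon
    rw [Fintype.not_linearIndependent_iff] at hcon
    obtain ⟨c, hc, i, hi⟩ := hcon
    obtain ⟨f', hf', heq⟩ := h.exists_eq_wronskian_div (c := c) fun h0 => hi (by simp [h0])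
    rw [hc] at heq
    obtain ⟨x, hx⟩ := (eventually_wronskian_div_ne_zero (fun i => hf'.mem_entire i.castSucc)
      hf'.mem_entire hf'.castSucc_linearIndependent hf'.linearIndependent 0).exists
    exact hx (congrFun heq x).symm
  rw [h.conjugateSpace_eq, finrank_span_eq_card hind, Fintype.card_fin]

/-- The exponents of the conjugate space are at most `dim V - 1`. -/
theorem meromorphicOrderAt_conjugate_le {m : ℕ} {f : Fin (m + 1) → ℂ → ℂ} (h : IsFamilyBasis V f)
    (z : ℂ) : meromorphicOrderAt
      (fun x => wronskian (fun i : Fin m => f i.castSucc) x / wronskian f x) z ≤ (m : ℤ) := by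
  set g := fun i : Fin m => f i.castSucc with hg
  have hge : ∀ i, g i ∈ entire := fun i => h.mem_entire _
  -- The reciprocal is a monic operator of order `m` applied to an entire function, so its pole has
  -- order at most `m`.
  have h1 : (fun x => wronskian g x / wronskian f x) = (monicOp g (f (Fin.last m)))⁻¹ := by
    rw [monicOp_eq_wronskian_div]
    funext x
    simp [inv_div, hg]
  rw [h1, meromorphicOrderAt_inv]
  have hm : MeromorphicAt (monicOp g (f (Fin.last m))) z := by
    rw [monicOp_eq_wronskian_div]
    exact meromorphicAt_wronskian_div h.mem_entire hge z
  have hle : ((-(m : ℤ) : ℤ) : WithTop ℤ) ≤ meromorphicOrderAt (monicOp g (f (Fin.last m))) z := by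
    have h2 : monicOp g (f (Fin.last m)) = ∑ k : Fin (m + 1),
        opCoeff g k * iteratedDeriv (k : ℕ) (f (Fin.last m)) := by
      funext x
      simp [monicOp]
    have h3 : ∀ s : Finset (Fin (m + 1)), MeromorphicAt (∑ k ∈ s,
        opCoeff g k * iteratedDeriv (k : ℕ) (f (Fin.last m))) z ∧
        ((-(m : ℤ) : ℤ) : WithTop ℤ) ≤ meromorphicOrderAt (∑ k ∈ s,
          opCoeff g k * iteratedDeriv (k : ℕ) (f (Fin.last m))) z := fun s => by
      induction s using Finset.induction_on with
      | empty =>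
        rw [Finset.sum_empty, (meromorphicOrderAt_eq_top_iff (f := (0 : ℂ → ℂ))).2
          (Eventually.of_forall fun _ => rfl)]
        exact ⟨MeromorphicAt.const 0 z, le_top⟩
      | insert k s hk ih =>
        rw [Finset.sum_insert hk]
        have ha := meromorphicAt_opCoeff hge k z
        have hie := iteratedDeriv_mem_entire (h.mem_entire (Fin.last m)) k
        have hi := meromorphicAt_of_entire hie z
        refine ⟨(ha.mul hi).add ih.1, le_meromorphicOrderAt_add (ha.mul hi) ih.1 ?_ ih.2⟩
        have h4 := le_meromorphicOrderAt_mul (t := 0) ha hi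
          (le_meromorphicOrderAt_opCoeff hge h.castSucc_linearIndependent z k)
          (hie.analyticAt z).meromorphicOrderAt_nonneg
        refine le_trans ?_ h4
        exact_mod_cast (by omega : -(m : ℤ) ≤ (k : ℕ) - (m : ℤ) + 0)
    rw [h2]
    exact (h3 _).2
  have htop : meromorphicOrderAt (monicOp g (f (Fin.last m))) z ≠ ⊤ := by
    rw [meromorphicOrderAt_ne_top_iff_eventually_ne_zero hm, monicOp_eq_wronskian_div]
    exact eventually_wronskian_div_ne_zero h.mem_entire hge h.linearIndependent
      h.castSucc_linearIndependent z
  lift meromorphicOrderAt (monicOp g (f (Fin.last m))) z to ℤ using htop with n hn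
  have : -(m : ℤ) ≤ n := by exact_mod_cast hle
  change ((-n : ℤ) : WithTop ℤ) ≤ ((m : ℤ) : WithTop ℤ)
  exact_mod_cast (by omega : -n ≤ (m : ℤ))

end IsFamilyBasis

/-! ### Rational functions regular at infinity -/

/-- `b` is, outside a finite set, a rational function with the value `q` at infinity. -/
def IsProper (b : ℂ → ℂ) (q : ℂ) : Prop :=
  ∃ n d : ℂ[X], d ≠ 0 ∧ n.natDegree ≤ d.natDegree ∧ n.coeff d.natDegree = q * d.leadingCoeff ∧
    ∀ᶠ x in cofinite, b x = n.eval x / d.eval x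

theorem eventually_eval_ne_zero {d : ℂ[X]} (hd : d ≠ 0) : ∀ᶠ x in cofinite, d.eval x ≠ 0 := by
  rw [Filter.eventually_cofinite]
  simpa using d.finite_setOfPred_isRoot hd

theorem eventually_cofinite_nhds {P : ℂ → Prop} (h : ∀ᶠ x in cofinite, P x) :
    ∀ᶠ x in cofinite, ∀ᶠ y in 𝓝 x, P y := by
  have hfin : {x | ¬ P x}.Finite := Filter.eventually_cofinite.1 h
  filter_upwards [h] with x hx
  have : {x | ¬ P x}ᶜ ∈ 𝓝 x := hfin.isClosed.isOpen_compl.mem_nhds (by simpa using hx)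
  filter_upwards [this] with y hy
  simpa using hy

namespace IsProper

variable {a b : ℂ → ℂ} {p q : ℂ}

theorem congr (hb : IsProper b q) (h : ∀ᶠ x in cofinite, a x = b x) : IsProper a q := by
  obtain ⟨n, d, hd, h1, h2, h3⟩ := hb
  refine ⟨n, d, hd, h1, h2, ?_⟩
  filter_upwards [h, h3] with x h h3 using h.trans h3

theorem const (c : ℂ) : IsProper (fun _ => c) c :=
  ⟨C c, 1, one_ne_zero, by simp, by simp, by simp⟩

theorem add (ha : IsProper a p) (hb : IsProper b q) : IsProper (a + b) (p + q) := by
  obtain ⟨n, d, hd, h1, h2, h3⟩ := ha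
  obtain ⟨n', d', hd', h1', h2', h3'⟩ := hb
  refine ⟨n * d' + d * n', d * d', mul_ne_zero hd hd', ?_, ?_, ?_⟩
  · rw [natDegree_mul hd hd']
    refine natDegree_add_le_of_degree_le ?_ ?_
    · exact natDegree_mul_le_of_le h1 le_rfl
    · exact natDegree_mul_le_of_le le_rfl h1'
  · rw [natDegree_mul hd hd', coeff_add, coeff_mul_add_eq_of_natDegree_le h1 le_rfl,
      coeff_mul_add_eq_of_natDegree_le le_rfl h1', h2, h2', leadingCoeff_mul, coeff_natDegree,
      coeff_natDegree]
    ring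
  · filter_upwards [h3, h3', eventually_eval_ne_zero hd, eventually_eval_ne_zero hd']
      with x e e' hx hx'
    rw [Pi.add_apply, e, e']
    simp only [eval_add, eval_mul]
    field_simp

theorem mul (ha : IsProper a p) (hb : IsProper b q) : IsProper (a * b) (p * q) := by
  obtain ⟨n, d, hd, h1, h2, h3⟩ := ha
  obtain ⟨n', d', hd', h1', h2', h3'⟩ := hb
  refine ⟨n * n', d * d', mul_ne_zero hd hd', ?_, ?_, ?_⟩
  · rw [natDegree_mul hd hd']
    exact natDegree_mul_le_of_le h1 h1'
  · rw [natDegree_mul hd hd', coeff_mul_add_eq_of_natDegree_le h1 h1', h2, h2', leadingCoeff_mul]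
    ring
  · filter_upwards [h3, h3'] with x e e'
    rw [Pi.mul_apply, e, e', eval_mul, eval_mul, div_mul_div_comm]

theorem sub (ha : IsProper a p) (hb : IsProper b q) : IsProper (a - b) (p - q) := by
  have := ha.add ((const (-1)).mul hb)
  have e : a - b = a + (fun _ => -1) * b := by
    funext x
    simp [sub_eq_add_neg]
  rw [e]
  convert this using 1
  ring

/-- Over the denominator `d²`, the numerator `n'd - d'n` has zero coefficient in degree `2 deg d`.
-/
theorem deriv (hb : IsProper b q) : IsProper (deriv b) 0 := by
  obtain ⟨n, d, hd, h1, h2, h3⟩ := hb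
  have hdeg : ∀ {u v : ℂ[X]}, u.natDegree ≤ d.natDegree → v.natDegree ≤ d.natDegree →
      (derivative u * v).natDegree ≤ d.natDegree + d.natDegree ∧
      (derivative u * v).coeff (d.natDegree + d.natDegree) = 0 := by
    intro u v hu hv
    have hu' : (derivative u).natDegree ≤ d.natDegree :=
      (natDegree_derivative_le u).trans (by omega)
    refine ⟨natDegree_mul_le_of_le hu' hv, ?_⟩
    rw [coeff_mul_add_eq_of_natDegree_le hu' hv, coeff_derivative,
      coeff_eq_zero_of_natDegree_lt (Nat.lt_succ_of_le hu)]
    simp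
  refine ⟨derivative n * d - derivative d * n, d * d, mul_ne_zero hd hd, ?_, ?_, ?_⟩
  · rw [natDegree_mul hd hd]
    exact natDegree_sub_le_of_le (hdeg h1 le_rfl).1 (hdeg le_rfl h1).1 |>.trans (by simp)
  · rw [natDegree_mul hd hd, coeff_sub, (hdeg h1 le_rfl).2, (hdeg le_rfl h1).2]
    simp
  · filter_upwards [eventually_cofinite_nhds h3, eventually_eval_ne_zero hd] with x e hx
    rw [Filter.EventuallyEq.deriv_eq (f := fun x => n.eval x / d.eval x) e,
      deriv_fun_div n.differentiableAt d.differentiableAt hx, Polynomial.deriv, Polynomial.deriv]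
    simp only [eval_sub, eval_mul]
    rw [pow_two, mul_comm (eval x n)]

theorem derivative_div {n : ℂ[X]} (hn : n ≠ 0) :
    IsProper (fun x => (derivative n).eval x / n.eval x) 0 := by
  refine ⟨derivative n, n, hn, (natDegree_derivative_le n).trans (by omega), ?_, by simp⟩
  rw [coeff_derivative, coeff_eq_zero_of_natDegree_lt (Nat.lt_succ_self _)]
  simp

end IsProper

/-! ### Wronskians of quasi-polynomials -/

section Homogeneous

variable {N : ℕ}

/-- The polynomial part of a generalized Wronskian of quasi-polynomials. -/
noncomputable def wronskianPoly (l : Fin N → ℂ) (p : Fin N → ℂ[X]) (d : Fin N → ℕ) : ℂ[X] :=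
  (Matrix.of fun a b : Fin N => (twistedDeriv (l a))^[d b] (p a)).det

/-- Each row carries its own exponential factor, which does not depend on the order of
differentiation. The exponentials cancel in quotients of such determinants, leaving rational
coefficients. -/
theorem genWronskian_expPoly (l : Fin N → ℂ) (p : Fin N → ℂ[X]) (d : Fin N → ℕ) (x : ℂ) :
    genWronskian (fun a => expPoly (l a) (p a)) d x =
      (∏ a, Complex.exp (l a * x)) * (wronskianPoly l p d).eval x := by
  have h := RingHom.map_det (Polynomial.evalRingHom x)
    (Matrix.of fun a b : Fin N => (twistedDeriv (l a))^[d b] (p a))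
  rw [coe_evalRingHom] at h
  rw [wronskianPoly, h, ← Matrix.det_mul_column, genWronskian]
  congr 1
  ext a b
  rw [Matrix.of_apply, iteratedDeriv_expPoly]
  simp [expPoly, mul_comm]

theorem wronskianPoly_ne_zero {l : Fin N → ℂ} {p : Fin N → ℂ[X]}
    (h : LinearIndependent ℂ fun a => expPoly (l a) (p a)) :
    wronskianPoly l p (fun b => (b : ℕ)) ≠ 0 := by
  intro h0
  obtain ⟨x, hx⟩ := exists_wronskian_ne_zero (fun a => expPoly_mem_entire _ _) h
  rw [wronskian, genWronskian_expPoly, h0] at hx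
  simp at hx

theorem eventually_wronskian_expPoly_ne_zero {l : Fin N → ℂ} {p : Fin N → ℂ[X]}
    (h : LinearIndependent ℂ fun a => expPoly (l a) (p a)) :
    ∀ᶠ x in cofinite, wronskian (fun a => expPoly (l a) (p a)) x ≠ 0 := by
  filter_upwards [eventually_eval_ne_zero (wronskianPoly_ne_zero h)] with x hx
  rw [wronskian, genWronskian_expPoly]
  exact mul_ne_zero (Finset.prod_ne_zero_iff.2 fun _ _ => Complex.exp_ne_zero _) hx

theorem logDeriv_eval_div {n d : ℂ[X]} {m x : ℂ} (hn : n.eval x ≠ 0) (hd : d.eval x ≠ 0) :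
    logDeriv (fun x => Complex.exp (m * x) * (n.eval x / d.eval x)) x =
      m + ((derivative n).eval x / n.eval x - (derivative d).eval x / d.eval x) := by
  have h1 : HasDerivAt (fun x : ℂ => Complex.exp (m * x)) (Complex.exp (m * x) * (m * 1)) x :=
    ((hasDerivAt_id x).const_mul m).cexp
  have h2 := (n.hasDerivAt x).div (d.hasDerivAt x) hd
  have h3 := h1.mul h2
  rw [logDeriv_apply]
  have h4 : deriv (fun x => Complex.exp (m * x) * (n.eval x / d.eval x)) x = _ := h3.deriv
  rw [h4]
  have := Complex.exp_ne_zero (m * x)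
  simp only [Pi.div_apply]
  field_simp

theorem monicOp_expPoly (l : Fin (N + 1) → ℂ) (p : Fin (N + 1) → ℂ[X]) (x : ℂ) :
    monicOp (fun a : Fin N => expPoly (l a.castSucc) (p a.castSucc))
      (expPoly (l (Fin.last N)) (p (Fin.last N))) x =
    Complex.exp (l (Fin.last N) * x) * ((wronskianPoly l p (fun b => (b : ℕ))).eval x /
      (wronskianPoly (fun a : Fin N => l a.castSucc) (fun a : Fin N => p a.castSucc)
        (fun b => (b : ℕ))).eval x) := by
  have h := monicOp_castSucc (fun a => expPoly (l a) (p a)) x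
  rw [h, wronskian, wronskian, genWronskian_expPoly,
    genWronskian_expPoly (fun a : Fin N => l a.castSucc), Fin.prod_univ_castSucc, mul_assoc,
    mul_div_mul_left _ _ (Finset.prod_ne_zero_iff.2 fun _ _ => Complex.exp_ne_zero _),
    mul_div_assoc]

/-- The coefficients of the monic operator of a space of quasi-polynomials are rational functions,
and the values at infinity are the coefficients of the characteristic polynomial. -/
theorem isProper_opCoeff {l : Fin N → ℂ} {p : Fin N → ℂ[X]}
    (hind : LinearIndependent ℂ fun a => expPoly (l a) (p a)) (k : Fin (N + 1)) :
    IsProper (opCoeff (fun a => expPoly (l a) (p a)) k) ((∏ a, (X - C (l a))).coeff k) := by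
  induction N with
  | zero =>
    obtain rfl : k = Fin.last 0 := Fin.ext (by simp)
    have : opCoeff (fun a => expPoly (l a) (p a)) (Fin.last 0) = fun _ => 1 := by
      funext x
      rw [opCoeff_last]
      simp [wronskian, genWronskian]
    rw [this]
    rw [Fin.prod_univ_zero, Fin.val_last, coeff_one_zero]
    exact IsProper.const 1
  | succ N ih =>
    set f := fun a => expPoly (l a) (p a) with hf
    set l' := fun a : Fin N => l a.castSucc with hl'
    set p' := fun a : Fin N => p a.castSucc with hp'
    set g := fun a => expPoly (l' a) (p' a) with hg
    have hgi : LinearIndependent ℂ g := hind.comp _ (Fin.castSucc_injective N)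
    set h := monicOp g (f (Fin.last N)) with hh
    set Q := ∏ a, (X - C (l' a)) with hQ
    -- Here `h` is `e^{λx}` times a rational function, with `λ` the last exponent, so `h'/h` tends
    -- to `λ` at infinity.
    have hlog : IsProper (logDeriv h) (l (Fin.last N)) := by
      have h1 := (IsProper.const (l (Fin.last N))).add
        ((IsProper.derivative_div (wronskianPoly_ne_zero hind)).sub
          (IsProper.derivative_div (wronskianPoly_ne_zero hgi)))
      rw [sub_zero, add_zero] at h1
      refine h1.congr ?_
      filter_upwards [eventually_eval_ne_zero (wronskianPoly_ne_zero hind),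
        eventually_eval_ne_zero (wronskianPoly_ne_zero hgi)] with x hx hx'
      have h2 : h = _ := funext fun x => monicOp_expPoly l p x
      rw [h2, logDeriv_eval_div hx hx']
      rfl
    have heq : ∀ᶠ x in cofinite, opCoeff f k x = stepCoeff g h k x := by
      filter_upwards [eventually_wronskian_expPoly_ne_zero hind,
        eventually_wronskian_expPoly_ne_zero hgi] with x h1 h2
      exact opCoeff_eq_stepCoeff (f := f) (fun a => expPoly_mem_entire _ _) h1 h2 k
    -- Composition with `∂ - h'/h` acts on the limits at infinity as multiplication by `X - λ`:
    -- derivatives of the coefficients tend to `0`. The `0` on the right records their contribution.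
    have hcoeff : (∏ a, (X - C (l a))).coeff k =
        (Q * X).coeff k + (0 - l (Fin.last N) * Q.coeff k) := by
      rw [Fin.prod_univ_castSucc, mul_sub, coeff_sub, coeff_mul_C]
      ring
    rw [hcoeff]
    refine IsProper.congr ?_ heq
    refine IsProper.add ?_ ?_
    · induction k using Fin.cases with
      | zero =>
        rw [Fin.cons_zero, Fin.val_zero, mul_coeff_zero, coeff_X_zero, mul_zero]
        exact IsProper.const 0
      | succ j =>
        rw [Fin.cons_succ, Fin.val_succ, coeff_mul_X]
        exact ih hgi j
    · induction k using Fin.lastCases with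
      | last =>
        have : Q.coeff (N + 1) = 0 := by
          refine coeff_eq_zero_of_natDegree_lt ?_
          rw [hQ, natDegree_prod_of_monic _ _ fun a _ => monic_X_sub_C _]
          simp
        rw [Fin.snoc_last, Fin.val_last, this, mul_zero, sub_zero]
        exact IsProper.const 0
      | cast j =>
        rw [Fin.snoc_castSucc, Fin.val_castSucc]
        exact (ih hgi j).deriv.sub (hlog.mul (ih hgi j))

end Homogeneous

/-! ### Clearing denominators -/

theorem meromorphicAt_eval (p : ℂ[X]) (z : ℂ) : MeromorphicAt (fun x => p.eval x) z :=
  meromorphicAt_of_entire p.differentiable z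

theorem meromorphicOrderAt_eval {p : ℂ[X]} (hp : p ≠ 0) (z : ℂ) :
    meromorphicOrderAt (fun x => p.eval x) z = ((p.rootMultiplicity z : ℕ) : ℤ) := by
  rw [meromorphicOrderAt_eq_int_iff (meromorphicAt_eval p z)]
  obtain ⟨q, hq, hdvd⟩ := exists_eq_pow_rootMultiplicity_mul_and_not_dvd p hp z
  refine ⟨fun x => q.eval x, q.differentiable.analyticAt z, ?_, ?_⟩
  · rwa [dvd_iff_isRoot] at hdvd
  · refine Eventually.of_forall fun x => ?_
    conv_lhs => rw [hq]
    simp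

/-- If `b = n/d` and `P b` has no poles, each root of `d` is a root of `n P` with at least the same
multiplicity, so `d ∣ n P` over `ℂ`. Comparing degrees and top coefficients in `n P = d A` gives the
rest. -/
theorem IsProper.exists_polynomial {b : ℂ → ℂ} {q : ℂ} (hb : IsProper b q) {P : ℂ[X]}
    (hP : P.Monic) (hord : ∀ z, 0 ≤ meromorphicOrderAt (fun x => P.eval x * b x) z) :
    ∃ A : ℂ[X], A.natDegree ≤ P.natDegree ∧ A.coeff P.natDegree = q ∧
      ∀ᶠ x in cofinite, P.eval x * b x = A.eval x := by
  obtain ⟨n, d, hd, h1, h2, h3⟩ := hb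
  have hdvd : d ∣ n * P := by
    by_cases hn : n * P = 0
    · rw [hn]
      exact dvd_zero d
    · rw [(IsAlgClosed.splits d).dvd_iff_roots_le_roots hd hn, Multiset.le_iff_count]
      intro z
      rw [count_roots, count_roots]
      have h4 : (fun x => P.eval x * b x) =ᶠ[𝓝[≠] z]
          fun x => (n * P).eval x / d.eval x := by
        filter_upwards [nhdsNE_le_cofinite z h3] with x hx
        rw [show b x = _ from hx, eval_mul]
        ring
      have h5 := hord z
      rw [meromorphicOrderAt_congr h4, show (fun x => (n * P).eval x / d.eval x) =
        (fun x => (n * P).eval x) / (fun x => d.eval x) from rfl, meromorphicOrderAt_div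
        (meromorphicAt_eval _ z) (meromorphicAt_eval _ z), meromorphicOrderAt_eval hn, meromorphicOrderAt_eval hd] at h5
      have h6 : (0 : ℤ) ≤ ((n * P).rootMultiplicity z : ℤ) - (d.rootMultiplicity z : ℤ) := by
        exact_mod_cast h5
      omega
  obtain ⟨A, hA⟩ := hdvd
  have hdeg : A.natDegree ≤ P.natDegree := by
    by_cases hA0 : A = 0
    · simp [hA0]
    · have h4 := congrArg natDegree hA
      rw [natDegree_mul hd hA0] at h4
      have h5 := natDegree_mul_le (p := n) (q := P)
      omega
  refine ⟨A, hdeg, ?_, ?_⟩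
  · have h4 := congrArg (fun r => r.coeff (d.natDegree + P.natDegree)) hA
    simp only [coeff_mul_add_eq_of_natDegree_le h1 le_rfl, coeff_mul_add_eq_of_natDegree_le le_rfl hdeg, h2,
      coeff_natDegree, hP.leadingCoeff, mul_one] at h4
    rw [mul_comm] at h4
    exact (mul_left_cancel₀ (leadingCoeff_ne_zero.2 hd) h4).symm
  · filter_upwards [h3, eventually_eval_ne_zero hd] with x e hx
    have h4 := congrArg (eval x) hA
    rw [eval_mul, eval_mul] at h4
    rw [e]
    field_simp
    rw [mul_comm, h4, mul_comm]

/-! ### Singular points -/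

theorem meromorphicOrderAt_entire_eq_iff {y : ℂ → ℂ} (hy : y ∈ entire) (z : ℂ) (e : ℕ) :
    meromorphicOrderAt y z = ((e : ℤ) : WithTop ℤ) ↔
      (∀ b < e, iteratedDeriv b y z = 0) ∧ iteratedDeriv e y z ≠ 0 := by
  have han : AnalyticAt ℂ y z := (mem_entire.1 hy).analyticAt z
  rw [← analyticOrderAt_eq_nat_iff_iteratedDeriv_eq_zero han, han.meromorphicOrderAt_eq]
  cases analyticOrderAt y z with
  | top => simp
  | coe n =>
    rw [ENat.map_natCast]
    norm_cast

theorem meromorphicOrderAt_entire_ne_top {y : ℂ → ℂ} (hy : y ∈ entire) (hy0 : y ≠ 0) (z : ℂ) :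
    meromorphicOrderAt y z ≠ ⊤ := fun h =>
  hy0 (eq_zero_of_entire_of_eventuallyEq hy (meromorphicOrderAt_eq_top_iff.1 h))

theorem exists_nat_meromorphicOrderAt_entire {y : ℂ → ℂ} (hy : y ∈ entire) (hy0 : y ≠ 0) (z : ℂ) :
    ∃ e : ℕ, meromorphicOrderAt y z = ((e : ℤ) : WithTop ℤ) := by
  have h1 := meromorphicOrderAt_entire_ne_top hy hy0 z
  have h2 := ((mem_entire.1 hy).analyticAt z).meromorphicOrderAt_nonneg
  lift meromorphicOrderAt y z to ℤ using h1 with n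
  have : 0 ≤ n := by exact_mod_cast h2
  exact ⟨n.toNat, by rw [Int.toNat_of_nonneg this]⟩

theorem iteratedDeriv_sum_smul_eq_vecMul {N : ℕ} {f : Fin N → ℂ → ℂ} (hf : ∀ a, f a ∈ entire)
    (c : Fin N → ℂ) (z : ℂ) (b : Fin N) :
    iteratedDeriv (b : ℕ) (∑ a, c a • f a) z = Matrix.vecMul c (wronskianMatrix f z) b := by
  rw [iteratedDeriv_sum_smul _ _ _ hf]
  rfl

/-- The polynomial `∏ (x - z)^(M_z)`, where the product is over a finite set `S` and `M_z` is the
order of the pole of the monic operator at `z`. -/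
noncomputable def polePoly (V : Submodule ℂ (ℂ → ℂ)) (S : Finset ℂ) : ℂ[X] :=
  ∏ z ∈ S, (X - C z) ^ poleOrder V z

theorem polePoly_monic (V : Submodule ℂ (ℂ → ℂ)) (S : Finset ℂ) :
    (polePoly V S).Monic := monic_prod_of_monic _ _ fun _ _ => (monic_X_sub_C _).pow _

theorem natDegree_polePoly (V : Submodule ℂ (ℂ → ℂ)) (S : Finset ℂ) :
    (polePoly V S).natDegree = ∑ z ∈ S, poleOrder V z := by
  rw [polePoly, natDegree_prod_of_monic _ _ fun _ _ => (monic_X_sub_C _).pow _]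
  simp

theorem eval_polePoly (V : Submodule ℂ (ℂ → ℂ)) (S : Finset ℂ) (x : ℂ) :
    (polePoly V S).eval x = ∏ z ∈ S, (x - z) ^ poleOrder V z := by
  simp [polePoly, eval_prod]

namespace IsFamilyBasis

variable {N : ℕ} {V : Submodule ℂ (ℂ → ℂ)} {f : Fin N → ℂ → ℂ}

/-- The Wronskian matrix sends coordinates to the derivatives of orders `0, …, N - 1` at `z`. If it
is singular, some nonzero element vanishes to order at least `N`; if it is invertible, these
derivatives can be prescribed, and they determine the element. -/
theorem exponents_eq_iff (h : IsFamilyBasis V f) (z : ℂ) :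
    exponents V z = Set.Ico (0 : ℤ) N ↔ wronskian f z ≠ 0 := by
  constructor
  · intro hexp hz
    obtain ⟨c, hc, hcM⟩ := Matrix.exists_vecMul_eq_zero_iff.2
      (show (wronskianMatrix f z).det = 0 from hz)
    have hyV : ∑ a, c a • f a ∈ V := h.mem_iff.2 ⟨c, rfl⟩
    have hye := h.le_entire hyV
    have hy0 : ∑ a, c a • f a ≠ 0 := fun h0 =>
      hc (funext (Fintype.linearIndependent_iff.1 h.linearIndependent c h0))
    obtain ⟨e, he⟩ := exists_nat_meromorphicOrderAt_entire hye hy0 z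
    have hmem : (e : ℤ) ∈ exponents V z := ⟨_, hyV, he⟩
    rw [hexp] at hmem
    have heN : e < N := by exact_mod_cast hmem.2
    refine ((meromorphicOrderAt_entire_eq_iff hye z e).1 he).2 ?_
    have := iteratedDeriv_sum_smul_eq_vecMul h.mem_entire c z ⟨e, heN⟩
    rw [hcM] at this
    exact this
  · intro hz
    have hdet : IsUnit (wronskianMatrix f z).det := isUnit_iff_ne_zero.2 hz
    ext e
    constructor
    · rintro ⟨y, hyV, hy⟩
      have hye := h.le_entire hyV
      have hy0 : y ≠ 0 := fun h0 => by
        rw [h0, (meromorphicOrderAt_eq_top_iff (f := (0 : ℂ → ℂ))).2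
          (Eventually.of_forall fun _ => rfl)] at hy
        exact WithTop.top_ne_coe hy
      obtain ⟨e', he'⟩ := exists_nat_meromorphicOrderAt_entire hye hy0 z
      have hee' : e = e' := by
        rw [he'] at hy
        exact_mod_cast hy.symm
      subst hee'
      refine ⟨Int.natCast_nonneg _, ?_⟩
      by_contra hlt
      have hle : N ≤ e' := by
        have := not_lt.1 hlt
        exact_mod_cast this
      obtain ⟨c, rfl⟩ := h.mem_iff.1 hyV
      refine hy0 ?_
      have : Matrix.vecMul c (wronskianMatrix f z) = 0 := funext fun b => by
        rw [← iteratedDeriv_sum_smul_eq_vecMul h.mem_entire]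
        exact ((meromorphicOrderAt_entire_eq_iff hye z e').1 he').1 b (by omega)
      simp [Matrix.eq_zero_of_vecMul_eq_zero hdet.ne_zero this]
    · rintro ⟨h0, hN⟩
      lift e to ℕ using h0
      have heN : e < N := by exact_mod_cast hN
      set c : Fin N → ℂ := Matrix.vecMul (Pi.single ⟨e, heN⟩ 1) (wronskianMatrix f z)⁻¹ with hc
      have hcM : Matrix.vecMul c (wronskianMatrix f z) = Pi.single ⟨e, heN⟩ 1 := by
        rw [hc, Matrix.vecMul_vecMul, Matrix.nonsing_inv_mul _ hdet, Matrix.vecMul_one]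
      have hyV : ∑ a, c a • f a ∈ V := h.mem_iff.2 ⟨c, rfl⟩
      refine ⟨_, hyV, (meromorphicOrderAt_entire_eq_iff (h.le_entire hyV) z e).2 ⟨?_, ?_⟩⟩
      · intro b hb
        have := iteratedDeriv_sum_smul_eq_vecMul h.mem_entire c z ⟨b, hb.trans heN⟩
        rw [hcM] at this
        rw [this, Pi.single_eq_of_ne]
        exact fun hbe => hb.ne (congrArg Fin.val hbe)
      · have := iteratedDeriv_sum_smul_eq_vecMul h.mem_entire c z ⟨e, heN⟩
        rw [hcM] at this
        simp only at this
        rw [this, Pi.single_eq_same]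
        exact one_ne_zero

theorem mem_singularPoints_iff (h : IsFamilyBasis V f) {z : ℂ} :
    z ∈ singularPoints V ↔ wronskian f z = 0 := by
  rw [singularPoints, Set.mem_ofPred_eq, h.finrank_eq, Ne, h.exponents_eq_iff, not_not]

theorem notMem_singularPoints_iff (h : IsFamilyBasis V f) {z : ℂ} :
    z ∉ singularPoints V ↔ wronskian f z ≠ 0 := not_congr h.mem_singularPoints_iff

theorem meromorphicAt_opCoeff (h : IsFamilyBasis V f) (k : Fin (N + 1)) (z : ℂ) :
    MeromorphicAt (opCoeff f k) z := Bispectral.meromorphicAt_opCoeff h.mem_entire k z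

theorem poleOrder_eq (h : IsFamilyBasis V f) (z : ℂ) : poleOrder V z =
    sInf {m : ℕ | ∀ k, 0 ≤ meromorphicOrderAt (fun x => (x - z) ^ m * opCoeff f k x) z} := by
  have := h.finiteDimensional
  obtain rfl := h.finrank_eq
  have : ∀ k, monicCoeff V k = opCoeff f k := fun k =>
    h.opCoeff_eq (isFamilyBasis_basisOf h.le_entire) k
  simp only [poleOrder, this]

/-- By the Fuchsian bound the exponent `N` always suffices. Thus the infimum defining the pole order
is over a nonempty set, hence attained, and it is at most `N`. -/
theorem meromorphicOrderAt_pow_mul_opCoeff (h : IsFamilyBasis V f) (z : ℂ) (k : Fin (N + 1)) :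
    0 ≤ meromorphicOrderAt (fun x => (x - z) ^ N * opCoeff f k x) z := by
  have h1 : meromorphicOrderAt (fun x => (x - z) ^ N) z = ((N : ℤ) : WithTop ℤ) := by
    have := meromorphicOrderAt_pow_id_sub_const (x := z) (n := N)
    exact this
  have hm : MeromorphicAt (fun x => (x - z) ^ N) z := by fun_prop
  have h2 := le_meromorphicOrderAt_mul hm (h.meromorphicAt_opCoeff k z) h1.ge
    (le_meromorphicOrderAt_opCoeff h.mem_entire h.linearIndependent z k)
  refine le_trans ?_ h2
  exact_mod_cast (by omega : (0 : ℤ) ≤ N + ((k : ℕ) - N))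

theorem poleOrder_le (h : IsFamilyBasis V f) (z : ℂ) : poleOrder V z ≤ N := by
  rw [h.poleOrder_eq]
  exact Nat.sInf_le (h.meromorphicOrderAt_pow_mul_opCoeff z)

theorem meromorphicOrderAt_poleOrder (h : IsFamilyBasis V f) (z : ℂ) (k : Fin (N + 1)) :
    0 ≤ meromorphicOrderAt (fun x => (x - z) ^ poleOrder V z * opCoeff f k x) z := by
  rw [h.poleOrder_eq]
  exact Nat.sInf_mem (s := {m : ℕ | ∀ k, 0 ≤ meromorphicOrderAt
    (fun x => (x - z) ^ m * opCoeff f k x) z}) ⟨N, h.meromorphicOrderAt_pow_mul_opCoeff z⟩ k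

theorem meromorphicOrderAt_polePoly_mul (h : IsFamilyBasis V f) {S : Finset ℂ}
    (hS : ∀ z, z ∈ S ↔ z ∈ singularPoints V) (z : ℂ) (k : Fin (N + 1)) :
    0 ≤ meromorphicOrderAt (fun x => (polePoly V S).eval x * opCoeff f k x) z := by
  classical
  by_cases hz : z ∈ S
  · set R := ∏ w ∈ S.erase z, (X - C w) ^ poleOrder V w with hR
    have h1 : (fun x => (polePoly V S).eval x * opCoeff f k x) =
        (fun x => R.eval x) * fun x => (x - z) ^ poleOrder V z * opCoeff f k x := by
      funext x
      rw [Pi.mul_apply, polePoly, ← Finset.mul_prod_erase S _ hz, ← hR]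
      simp
      ring
    have hm : MeromorphicAt (fun x => (x - z) ^ poleOrder V z * opCoeff f k x) z :=
      MeromorphicAt.mul (by fun_prop) (h.meromorphicAt_opCoeff k z)
    rw [h1, meromorphicOrderAt_mul (meromorphicAt_eval _ _) hm]
    exact add_nonneg (R.differentiable.analyticAt z).meromorphicOrderAt_nonneg
      (h.meromorphicOrderAt_poleOrder z k)
  · rw [hS, h.notMem_singularPoints_iff] at hz
    refine AnalyticAt.meromorphicOrderAt_nonneg (AnalyticAt.mul
      ((polePoly V S).differentiable.analyticAt z) ?_)
    have hd : DifferentiableOn ℂ (opCoeff f k) {x | wronskian f x ≠ 0} := fun x hx =>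
      (differentiableAt_opCoeff h.mem_entire hx k).differentiableWithinAt
    exact hd.analyticAt ((isOpen_wronskian_ne_zero h.mem_entire).mem_nhds hz)

end IsFamilyBasis

theorem IsHomogeneousBasis.finite_singularPoints {N : ℕ} {V : Submodule ℂ (ℂ → ℂ)}
    {l : Fin N → ℂ} {p : Fin N → ℂ[X]} (h : IsHomogeneousBasis V l p) :
    (singularPoints V).Finite := by
  have := eventually_wronskian_expPoly_ne_zero h.linearIndependent
  rw [Filter.eventually_cofinite] at this
  refine this.subset fun z hz => ?_
  simpa using h.isFamilyBasis.mem_singularPoints_iff.1 hz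

/-- The polynomial coefficients of the operator obtained from the monic operator by clearing the
denominators. -/
theorem IsHomogeneousBasis.exists_polynomial {N : ℕ} {V : Submodule ℂ (ℂ → ℂ)}
    {l : Fin N → ℂ} {p : Fin N → ℂ[X]} (h : IsHomogeneousBasis V l p) {S : Finset ℂ}
    (hS : ∀ z, z ∈ S ↔ z ∈ singularPoints V) :
    ∃ A : Fin (N + 1) → ℂ[X], (∀ k, (A k).natDegree ≤ (polePoly V S).natDegree) ∧
      (∀ k, (A k).coeff (polePoly V S).natDegree = (∏ a, (X - C (l a))).coeff k) ∧
      ∀ k x, x ∉ S → (polePoly V S).eval x * opCoeff (fun a => expPoly (l a) (p a)) k x =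
        (A k).eval x := by
  have hf := h.isFamilyBasis
  choose A h1 h2 h3 using fun k => (isProper_opCoeff h.linearIndependent k).exists_polynomial
    (polePoly_monic V S) fun z => hf.meromorphicOrderAt_polePoly_mul hS z k
  refine ⟨A, h1, h2, fun k x hx => ?_⟩
  rw [hS, hf.notMem_singularPoints_iff] at hx
  -- The identity holds off a finite set; continuity extends it to every nonsingular point.
  have hc1 : ContinuousAt (fun x => (polePoly V S).eval x *
      opCoeff (fun a => expPoly (l a) (p a)) k x) x :=
    (polePoly V S).continuousAt.mul (differentiableAt_opCoeff hf.mem_entire hx k).continuousAt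
  exact ((hc1.eventuallyEq_nhds_iff_eventuallyEq_nhdsNE (A k).continuousAt).1
    (nhdsNE_le_cofinite x (h3 k))).eq_of_nhds

/-! ### Residues -/

/-- `f` is holomorphic on the closed disc `|x - z| ≤ r` except for at most a pole at `z`. -/
structure IsPunctured (f : ℂ → ℂ) (z : ℂ) (r : ℝ) : Prop where
  differentiableAt : ∀ x ∈ Metric.closedBall z r \ {z}, DifferentiableAt ℂ f x
  meromorphicAt : MeromorphicAt f z

namespace IsPunctured

variable {f g : ℂ → ℂ} {z : ℂ} {r : ℝ}

theorem mul (hf : IsPunctured f z r) (hg : IsPunctured g z r) : IsPunctured (f * g) z r :=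
  ⟨fun x hx => (hf.differentiableAt x hx).mul (hg.differentiableAt x hx),
    hf.meromorphicAt.mul hg.meromorphicAt⟩

theorem of_entire (hf : f ∈ entire) : IsPunctured f z r :=
  ⟨fun x _ => mem_entire.1 hf x, meromorphicAt_of_entire hf z⟩

theorem sub_zpow (n : ℤ) : IsPunctured (fun x => (x - z) ^ n) z r := by
  refine ⟨fun x hx => ?_, by fun_prop⟩
  exact (differentiableAt_id.sub_const z).zpow (Or.inl (sub_ne_zero.2 hx.2))

theorem sphere_subset (hr : 0 < r) : Metric.sphere z r ⊆ Metric.closedBall z r \ {z} := by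
  intro x hx
  refine ⟨Metric.sphere_subset_closedBall hx, fun h => ?_⟩
  rw [Set.mem_singleton_iff.1 h, Metric.mem_sphere, dist_self] at hx
  exact hr.ne hx

theorem continuousOn_sphere (hf : IsPunctured f z r) (hr : 0 < r) :
    ContinuousOn f (Metric.sphere z r) := fun x hx =>
  (hf.differentiableAt x (sphere_subset hr hx)).continuousAt.continuousWithinAt

theorem circleIntegrable (hf : IsPunctured f z r) (hr : 0 < r) : CircleIntegrable f z r :=
  (hf.continuousOn_sphere hr).circleIntegrable hr.le

theorem circleIntegral_eq (hf : IsPunctured f z r) (hr : 0 < r) {y : ℂ}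
    (hy : Tendsto (fun x => (x - z) * f x) (𝓝[≠] z) (𝓝 y)) :
    ∮ x in C(z, r), f x = (2 * Real.pi * Complex.I : ℂ) * y := by
  have hg : IsPunctured (fun x => (x - z) * f x) z r := by
    have := (sub_zpow (z := z) (r := r) 1).mul hf
    simp only [zpow_one] at this
    exact this
  have h := Complex.circleIntegral_sub_center_inv_smul_of_differentiable_on_off_countable_of_tendsto
    hr Set.countable_empty
    (fun x hx => (hg.differentiableAt x hx).continuousAt.continuousWithinAt)
    (fun x hx => hg.differentiableAt x ⟨Metric.ball_subset_closedBall hx.1.1, hx.1.2⟩) hy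
  rw [smul_eq_mul] at h
  rw [← h]
  refine circleIntegral.integral_congr hr.le fun x hx => ?_
  have hxz : x - z ≠ 0 := sub_ne_zero.2 (sphere_subset hr hx).2
  simp only [smul_eq_mul]
  field_simp

theorem circleIntegral_eq_zero (hf : IsPunctured f z r) (hr : 0 < r)
    (h0 : 0 ≤ meromorphicOrderAt f z) : ∮ x in C(z, r), f x = 0 := by
  rw [hf.circleIntegral_eq hr (y := 0), mul_zero]
  obtain ⟨g, hg, hfg⟩ := hf.meromorphicAt.meromorphicOrderAt_nonneg_iff.1 h0
  have h1 : Tendsto (fun x => (x - z) * g x) (𝓝[≠] z) (𝓝 ((z - z) * g z)) :=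
    ((continuousAt_id.sub continuousAt_const).mul hg.continuousAt).tendsto.mono_left
      nhdsWithin_le_nhds
  rw [sub_self, zero_mul] at h1
  refine h1.congr' ?_
  filter_upwards [hfg] with x hx using by rw [hx]

/-- The factor `(x - z)^(-n - 1)` turns the leading Laurent coefficient into a residue. -/
theorem circleIntegral_ne_zero (hf : IsPunctured f z r) (hr : 0 < r) {n : ℤ}
    (hn : meromorphicOrderAt f z = n) : ∮ x in C(z, r), (x - z) ^ (-n - 1) * f x ≠ 0 := by
  obtain ⟨g, hg, hg0, hfg⟩ := (meromorphicOrderAt_eq_int_iff hf.meromorphicAt).1 hn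
  have h := ((sub_zpow (z := z) (r := r) (-n - 1)).mul hf).circleIntegral_eq hr (y := g z) (by
    have h1 : Tendsto g (𝓝[≠] z) (𝓝 (g z)) := hg.continuousAt.tendsto.mono_left nhdsWithin_le_nhds
    refine h1.congr' ?_
    filter_upwards [hfg, self_mem_nhdsWithin] with x hx hxz
    have hxz' : x - z ≠ 0 := sub_ne_zero.2 hxz
    rw [Pi.mul_apply, hx, smul_eq_mul, ← mul_assoc, ← mul_assoc, ← zpow_one_add₀ hxz',
      ← zpow_add₀ hxz']
    ring_nf
    simp)
  have h2 : ∮ x in C(z, r), (x - z) ^ (-n - 1) * f x =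
      ∮ x in C(z, r), ((fun x => (x - z) ^ (-n - 1)) * f) x := rfl
  rw [h2, h]
  exact mul_ne_zero Complex.two_pi_I_ne_zero hg0

theorem exists_pow_mul_nonneg (hf : IsPunctured f z r) :
    ∃ m : ℕ, 0 ≤ meromorphicOrderAt ((fun x => (x - z) ^ m) * f) z := by
  obtain ⟨m, hm⟩ := hf.meromorphicAt
  refine ⟨m, ?_⟩
  have : ((fun x => (x - z) ^ m) * f) = fun x => (x - z) ^ m • f x := rfl
  rw [this]
  exact hm.meromorphicOrderAt_nonneg

/-- The integral transform of a function with a pole at `z` is a quasi-polynomial with exponent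
`z`. -/
theorem exists_transform_eq (hf : IsPunctured f z r) (hr : 0 < r) {m : ℕ}
    (hm : 0 ≤ meromorphicOrderAt ((fun x => (x - z) ^ m) * f) z) :
    (fun u => ∮ x in C(z, r), Complex.exp (u * x) * f x) =
      expPoly z (∑ i ∈ Finset.range m,
        C ((∮ x in C(z, r), (x - z) ^ i * f x) / i.factorial) * X ^ i) := by
  funext u
  -- Split `e^{u(x - z)}` into its Taylor polynomial of degree below `m` and a remainder divisible
  -- by `(x - z)^m`. The remainder cancels the pole and integrates to zero, so only the first `m`
  -- moments of `f` survive.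
  obtain ⟨F, hF, hexp⟩ := AnalyticAt.exists_eq_sum_add_pow_mul
    (f := Complex.exp) (by fun_prop : AnalyticAt ℂ Complex.exp 0) m
  have hexp' : ∀ w, Complex.exp w = ∑ i ∈ Finset.range m, w ^ i / i.factorial + w ^ m * F w := by
    intro w
    conv_lhs => rw [hexp w]
    simp [iteratedDeriv_eq_iterate, Complex.iter_deriv_exp]
  set T : ℂ → ℂ := fun x => ∑ i ∈ Finset.range m, (u * (x - z)) ^ i / i.factorial with hT
  set E : ℂ → ℂ := fun x => Complex.exp (u * (x - z)) - T x with hE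
  have hTe : T ∈ entire := by
    rw [mem_entire]
    exact Differentiable.fun_sum fun i _ => by fun_prop
  have hEe : E ∈ entire := by
    refine entire.sub_mem (x := fun x => Complex.exp (u * (x - z))) ?_ hTe
    rw [mem_entire]
    fun_prop
  have hzero : ∮ x in C(z, r), (E * f) x = 0 := by
    refine ((of_entire hEe).mul hf).circleIntegral_eq_zero hr ?_
    have h1 : E * f = ((fun x => (x - z) ^ m) * f) * fun x => u ^ m * F (u * (x - z)) := by
      funext x
      simp only [hE, hT, Pi.mul_apply]
      rw [hexp' (u * (x - z)), mul_pow]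
      ring
    have h2 : AnalyticAt ℂ (fun x => u ^ m * F (u * (x - z))) z := by
      refine analyticAt_const.mul (AnalyticAt.fun_comp (g := F) ?_ (by fun_prop))
      simpa using hF
    rw [h1, meromorphicOrderAt_mul (((by fun_prop : MeromorphicAt (fun x => (x - z) ^ m) z)).mul
      hf.meromorphicAt) h2.meromorphicAt]
    exact add_nonneg hm h2.meromorphicOrderAt_nonneg
  have hi : ∀ i : ℕ, CircleIntegrable (fun x => (x - z) ^ i * f x) z r := fun i => by
    have := ((sub_zpow (z := z) (r := r) i).mul hf).circleIntegrable hr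
    simp only [zpow_natCast] at this
    exact this
  have hsum : ∮ x in C(z, r), (T * f) x = ∑ i ∈ Finset.range m,
      u ^ i / i.factorial * ∮ x in C(z, r), (x - z) ^ i * f x := by
    have h1 : ∀ x, (T * f) x = ∑ i ∈ Finset.range m,
        u ^ i / i.factorial * ((x - z) ^ i * f x) := fun x => by
      simp only [hT, Pi.mul_apply, Finset.sum_mul]
      exact Finset.sum_congr rfl fun i _ => by rw [mul_pow]; ring
    simp only [h1]
    rw [circleIntegral.integral_fun_sum]
    · simp only [circleIntegral.integral_const_mul]
    · intro i _
      exact (hi i).const_smul (a := u ^ i / (i.factorial : ℂ))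
  have hsplit : ∀ x, Complex.exp (u * x) * f x =
      Complex.exp (u * z) * ((E * f) x + (T * f) x) := fun x => by
    simp only [hE, Pi.mul_apply]
    rw [show u * x = u * z + u * (x - z) by ring, Complex.exp_add]
    ring
  simp only [hsplit]
  rw [circleIntegral.integral_const_mul, circleIntegral.integral_add
    (((of_entire hEe).mul hf).circleIntegrable hr) (((of_entire hTe).mul hf).circleIntegrable hr),
    hzero, hsum, zero_add]
  simp only [expPoly, LinearMap.coe_mk, AddHom.coe_mk, eval_finsetSum, eval_mul, eval_C, eval_pow,
    eval_X]
  rw [mul_comm, mul_comm u z]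
  congr 1
  exact Finset.sum_congr rfl fun i _ => by ring

theorem transform_mem_range (hf : IsPunctured f z r) (hr : 0 < r) :
    ∃ q, (fun u => ∮ x in C(z, r), Complex.exp (u * x) * f x) = expPoly z q := by
  obtain ⟨m, hm⟩ := hf.exists_pow_mul_nonneg
  exact ⟨_, hf.exists_transform_eq hr hm⟩

/-- If the integral transform of `f` vanishes, then `f` has no pole. -/
theorem meromorphicOrderAt_nonneg_of_transform_eq_zero (hf : IsPunctured f z r) (hr : 0 < r)
    (h : (fun u => ∮ x in C(z, r), Complex.exp (u * x) * f x) = 0) :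
    0 ≤ meromorphicOrderAt f z := by
  by_contra hneg
  obtain ⟨m, hm⟩ := hf.exists_pow_mul_nonneg
  have htop : meromorphicOrderAt f z ≠ ⊤ := fun ht => hneg (ht ▸ le_top)
  obtain ⟨n, hn⟩ := WithTop.ne_top_iff_exists.1 htop
  have hn0 : n < 0 := by
    rw [← hn] at hneg
    exact not_le.1 fun h => hneg (by exact_mod_cast h)
  have hmn : 0 ≤ (m : ℤ) + n := by
    have h1 : meromorphicOrderAt (fun x => (x - z) ^ m) z = ((m : ℤ) : WithTop ℤ) :=
      meromorphicOrderAt_pow_id_sub_const (x := z) (n := m)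
    rw [meromorphicOrderAt_mul (by fun_prop) hf.meromorphicAt, h1, ← hn] at hm
    exact_mod_cast hm
  have hq := hf.exists_transform_eq hr hm
  rw [h] at hq
  have hq0 := expPoly_injective z ((map_zero _).trans hq)
  -- For a pole of order `-n > 0`, the moment of index `-n - 1` is `2πi` times the leading Laurent
  -- coefficient, hence nonzero.
  obtain ⟨i, hi⟩ : ∃ i : ℕ, (i : ℤ) = -n - 1 := ⟨(-n - 1).toNat, by omega⟩
  have him : i < m := by omega
  have hc := congrArg (fun q => q.coeff i) hq0
  simp only [coeff_zero, finsetSum_coeff, coeff_C_mul_X_pow] at hc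
  rw [Finset.sum_ite_eq, if_pos (Finset.mem_range.2 him)] at hc
  have hne := hf.circleIntegral_ne_zero hr hn.symm
  rw [← hi] at hne
  simp only [zpow_natCast] at hne
  exact div_ne_zero hne (Nat.cast_ne_zero.2 i.factorial_ne_zero) hc.symm

end IsPunctured

/-! ### Differentiation under the integral sign -/

theorem hasDerivAt_transform {f : ℂ → ℂ} {z : ℂ} {r : ℝ} (hr : 0 < r)
    (hf : ContinuousOn f (Metric.sphere z r)) (u₀ : ℂ) :
    HasDerivAt (fun u => ∮ x in C(z, r), Complex.exp (u * x) * f x)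
      (∮ x in C(z, r), Complex.exp (u₀ * x) * (x * f x)) u₀ := by
  have hfc : Continuous fun θ : ℝ => f (circleMap z r θ) :=
    hf.comp_continuous (continuous_circleMap z r) fun θ => circleMap_mem_sphere z hr.le θ
  have hdc : Continuous (deriv (circleMap z r)) := by
    rw [funext (deriv_circleMap z r)]
    exact (continuous_circleMap 0 r).mul continuous_const
  have hcm := continuous_circleMap z r
  have hF : ∀ u, Continuous fun θ : ℝ => deriv (circleMap z r) θ *
      (Complex.exp (u * circleMap z r θ) * f (circleMap z r θ)) :=
    fun u => hdc.mul ((continuous_const.mul hcm).cexp.mul hfc)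
  have hF' : ∀ u, Continuous fun θ : ℝ => deriv (circleMap z r) θ *
      (Complex.exp (u * circleMap z r θ) * (circleMap z r θ * f (circleMap z r θ))) :=
    fun u => hdc.mul ((continuous_const.mul hcm).cexp.mul (hcm.mul hfc))
  have key := (intervalIntegral.hasDerivAt_integral_of_dominated_loc_of_deriv_le
    (μ := MeasureTheory.volume) (a := 0) (b := 2 * Real.pi) (𝕜 := ℂ) (x₀ := u₀)
    (F := fun u θ => deriv (circleMap z r) θ *
      (Complex.exp (u * circleMap z r θ) * f (circleMap z r θ)))
    (F' := fun u θ => deriv (circleMap z r) θ *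
      (Complex.exp (u * circleMap z r θ) * (circleMap z r θ * f (circleMap z r θ))))
    (bound := fun θ => ‖deriv (circleMap z r) θ‖ * (Real.exp ((‖u₀‖ + 1) * ‖circleMap z r θ‖) *
      ‖circleMap z r θ * f (circleMap z r θ)‖))
    (s := Metric.ball u₀ 1) (Metric.ball_mem_nhds u₀ one_pos)
    (Eventually.of_forall fun u => (hF u).aestronglyMeasurable)
    ((hF u₀).intervalIntegrable _ _) (hF' u₀).aestronglyMeasurable ?_ ?_ ?_).2
  · simpa [circleIntegral] using key
  · refine Eventually.of_forall fun θ _ u hu => ?_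
    rw [norm_mul, norm_mul]
    refine mul_le_mul_of_nonneg_left (mul_le_mul_of_nonneg_right ?_ (norm_nonneg _))
      (norm_nonneg _)
    refine (Complex.norm_exp_le_exp_norm _).trans (Real.exp_le_exp.2 ?_)
    rw [norm_mul]
    refine mul_le_mul_of_nonneg_right ?_ (norm_nonneg _)
    have h1 : ‖u - u₀‖ < 1 := by simpa [dist_eq_norm] using hu
    have h2 := norm_le_norm_add_norm_sub' u u₀
    linarith
  · exact Continuous.intervalIntegrable (hdc.norm.mul
      ((Real.continuous_exp.comp (continuous_const.mul hcm.norm)).mul (hcm.mul hfc).norm)) _ _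
  · refine Eventually.of_forall fun θ _ u _ => ?_
    have h1 : HasDerivAt (fun u : ℂ => Complex.exp (u * circleMap z r θ))
        (Complex.exp (u * circleMap z r θ) * (1 * circleMap z r θ)) u :=
      ((hasDerivAt_id u).mul_const _).cexp
    have h2 := (h1.mul_const (f (circleMap z r θ))).const_mul (deriv (circleMap z r) θ)
    convert! h2 using 1
    ring

theorem iteratedDeriv_transform {f : ℂ → ℂ} {z : ℂ} {r : ℝ} (hr : 0 < r)
    (hf : ContinuousOn f (Metric.sphere z r)) (j : ℕ) :
    iteratedDeriv j (fun u => ∮ x in C(z, r), Complex.exp (u * x) * f x) =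
      fun u => ∮ x in C(z, r), Complex.exp (u * x) * (x ^ j * f x) := by
  induction j with
  | zero => simp
  | succ j ih =>
    rw [iteratedDeriv_succ, ih]
    funext u
    rw [(hasDerivAt_transform hr (f := fun x => x ^ j * f x)
      ((continuousOn_id.pow j).mul hf) u).deriv]
    congr 1
    funext x
    ring

/-! ### The dual space -/

theorem differentiableAt_of_mem_conjugateSpace {V : Submodule ℂ (ℂ → ℂ)} {m : ℕ}
    {f : Fin (m + 1) → ℂ → ℂ} (h : IsFamilyBasis V f) {g : ℂ → ℂ} (hg : g ∈ conjugateSpace V)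
    {x : ℂ} (hx : x ∉ singularPoints V) : DifferentiableAt ℂ g x := by
  by_cases hg0 : g = 0
  · rw [hg0]
    exact differentiableAt_const _
  · obtain ⟨f', hf', rfl⟩ := h.exists_eq_wronskian_div_of_mem hg hg0
    exact (wronskian_mem_entire (fun i => hf'.mem_entire i.castSucc) x).div
      (wronskian_mem_entire hf'.mem_entire x) (hf'.notMem_singularPoints_iff.1 hx)

theorem meromorphicAt_of_mem_conjugateSpace {V : Submodule ℂ (ℂ → ℂ)} {m : ℕ}
    {f : Fin (m + 1) → ℂ → ℂ} (h : IsFamilyBasis V f) {g : ℂ → ℂ} (hg : g ∈ conjugateSpace V)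
    (z : ℂ) : MeromorphicAt g z := by
  by_cases hg0 : g = 0
  · rw [hg0]
    exact MeromorphicAt.const 0 z
  · obtain ⟨f', hf', rfl⟩ := h.exists_eq_wronskian_div_of_mem hg hg0
    exact meromorphicAt_wronskian_div (fun i => hf'.mem_entire i.castSucc) hf'.mem_entire z

/-- The product of an element of the conjugate space and the value of the monic operator at an
entire function has vanishing residues. -/
theorem circleIntegral_mul_monicOp {V : Submodule ℂ (ℂ → ℂ)} {m : ℕ}
    {f : Fin (m + 1) → ℂ → ℂ} (h : IsFamilyBasis V f) {g : ℂ → ℂ} (hg : g ∈ conjugateSpace V)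
    {y : ℂ → ℂ} (hy : y ∈ entire) {z : ℂ} {r : ℝ} (hr : 0 ≤ r)
    (hsph : ∀ x ∈ Metric.sphere z r, x ∉ singularPoints V) :
    ∮ x in C(z, r), g x * monicOp f y x = 0 := by
  by_cases hg0 : g = 0
  · simp [hg0, circleIntegral]
  · obtain ⟨f', hf', rfl⟩ := h.exists_eq_wronskian_div_of_mem hg hg0
    -- The monic operator depends only on `V`, so it may be computed in the basis adapted to `g`,
    -- where the integrand is an exact derivative.
    have hop : monicOp f y = monicOp f' y := by
      funext x
      exact Finset.sum_congr rfl fun k _ => by rw [hf'.opCoeff_eq h]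
    rw [hop]
    exact circleIntegral.integral_eq_zero_of_hasDerivWithinAt hr fun x hx =>
      (hasDerivAt_wronskian_div hf'.mem_entire (exists_wronskian_ne_zero
        (fun i => hf'.mem_entire _) hf'.castSucc_linearIndependent) hy
        (hf'.notMem_singularPoints_iff.1 (hsph x hx))).hasDerivWithinAt

theorem eval_polePoly_ne_zero {V : Submodule ℂ (ℂ → ℂ)} {S : Finset ℂ} {x : ℂ} (hx : x ∉ S) :
    (polePoly V S).eval x ≠ 0 := by
  rw [eval_polePoly, Finset.prod_ne_zero_iff]
  exact fun z hz => pow_ne_zero _ (sub_ne_zero.2 fun h => hx (h ▸ hz))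

/-- The generating set is the image of the conjugate space under multiplication by a fixed function,
so it is already a subspace. -/
theorem mem_regConjugateSpace_iff {V : Submodule ℂ (ℂ → ℂ)} {S : Finset ℂ}
    (hS : ∀ z, z ∈ S ↔ z ∈ singularPoints V) {g : ℂ → ℂ} :
    g ∈ regConjugateSpace V ↔
      ∃ f ∈ conjugateSpace V, g = fun x => f x * ((polePoly V S).eval x)⁻¹ := by
  have hSV : singularPoints V = S := by
    ext z
    exact (hS z).symm
  have hset : {g | ∃ f ∈ conjugateSpace V, g = fun x => f x *
      ∏ᶠ z ∈ singularPoints V, ((x - z) ^ poleOrder V z)⁻¹} =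
      ((conjugateSpace V).map (LinearMap.mulRight ℂ fun x => ((polePoly V S).eval x)⁻¹) :
        Set (ℂ → ℂ)) := by
    ext g
    have : ∀ x, ∏ᶠ z ∈ singularPoints V, ((x - z) ^ poleOrder V z)⁻¹ =
        ((polePoly V S).eval x)⁻¹ := fun x => by
      rw [hSV, finprod_mem_coe_finset, eval_polePoly, Finset.prod_inv_distrib]
    simp only [this]
    constructor
    · rintro ⟨f, hf, rfl⟩
      exact ⟨f, hf, rfl⟩
    · rintro ⟨f, hf, rfl⟩
      exact ⟨f, hf, rfl⟩
  rw [regConjugateSpace, hset, Submodule.span_eq]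
  constructor
  · rintro ⟨f, hf, rfl⟩
    exact ⟨f, hf, rfl⟩
  · rintro ⟨f, hf, rfl⟩
    exact ⟨f, hf, rfl⟩

/-! ### Local transforms of the regularized conjugate space -/

section Transform

variable {V : Submodule ℂ (ℂ → ℂ)} {m : ℕ} {f : Fin (m + 1) → ℂ → ℂ} {S : Finset ℂ}

theorem isPunctured_of_mem_conjugateSpace (h : IsFamilyBasis V f)
    (hS : ∀ z, z ∈ S ↔ z ∈ singularPoints V) {z : ℂ} {r : ℝ}
    (hsep : ∀ w ∈ S, w ≠ z → r < dist w z) {g : ℂ → ℂ} (hg : g ∈ conjugateSpace V) :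
    IsPunctured (fun x => g x * ((polePoly V S).eval x)⁻¹) z r := by
  refine ⟨fun x hx => ?_, (meromorphicAt_of_mem_conjugateSpace h hg z).mul
    (meromorphicAt_eval _ z).inv⟩
  have hxS : x ∉ S := fun hxS => (hsep x hxS hx.2).not_ge hx.1
  exact (differentiableAt_of_mem_conjugateSpace h hg (fun hx => hxS ((hS x).2 hx))).mul
    ((polePoly V S).differentiableAt.inv (eval_polePoly_ne_zero hxS))

theorem exists_radius (S : Finset ℂ) (z : ℂ) :
    ∃ r : ℝ, 0 < r ∧ ∀ w ∈ S, w ≠ z → r < dist w z := by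
  classical
  have hopen : IsOpen ((S.erase z : Finset ℂ) : Set ℂ)ᶜ :=
    (S.erase z).finite_toSet.isClosed.isOpen_compl
  obtain ⟨ε, hε, hball⟩ := Metric.isOpen_iff.1 hopen z (by simp)
  refine ⟨ε / 2, half_pos hε, fun w hw hwz => ?_⟩
  by_contra hle
  exact hball (show dist w z < ε by linarith) (by simp [hw, hwz])

/-- If the transform of an element of the regularized conjugate space vanishes at `z`, then the
order of this element at `z` is between `0` and `N - 1 - M_z`. -/
theorem order_of_transform_eq_zero (h : IsFamilyBasis V f)
    (hS : ∀ z, z ∈ S ↔ z ∈ singularPoints V) {z : ℂ} (hz : z ∈ S) {r : ℝ} (hr : 0 < r)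
    (hsep : ∀ w ∈ S, w ≠ z → r < dist w z) {g : ℂ → ℂ} (hg : g ∈ conjugateSpace V) (hg0 : g ≠ 0)
    (h0 : (fun u => ∮ x in C(z, r), Complex.exp (u * x) *
      (g x * ((polePoly V S).eval x)⁻¹)) = 0) :
    ∃ n : ℕ, n < m + 1 - poleOrder V z ∧
      meromorphicOrderAt (fun x => g x * ((polePoly V S).eval x)⁻¹) z = (n : ℤ) := by
  classical
  have hnn := (isPunctured_of_mem_conjugateSpace h hS hsep hg).meromorphicOrderAt_nonneg_of_transform_eq_zero
    hr h0
  have hgm := meromorphicAt_of_mem_conjugateSpace h hg z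
  have hgle : meromorphicOrderAt g z ≤ (m : ℤ) := by
    obtain ⟨f', hf', rfl⟩ := h.exists_eq_wronskian_div_of_mem hg hg0
    exact hf'.meromorphicOrderAt_conjugate_le z
  have hPne := (polePoly_monic V S).ne_zero
  -- Only this inequality is needed: a larger multiplicity would lower the order of the quotient
  -- further.
  have hroot : poleOrder V z ≤ (polePoly V S).rootMultiplicity z := by
    rw [le_rootMultiplicity_iff hPne]
    exact Finset.dvd_prod_of_mem _ hz
  have hord : meromorphicOrderAt (fun x => g x * ((polePoly V S).eval x)⁻¹) z =
      meromorphicOrderAt g z - (((polePoly V S).rootMultiplicity z : ℕ) : ℤ) := by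
    have : (fun x => g x * ((polePoly V S).eval x)⁻¹) = g / fun x => (polePoly V S).eval x := by
      funext x
      rw [Pi.div_apply, div_eq_mul_inv]
    rw [this, meromorphicOrderAt_div hgm (meromorphicAt_eval _ z), meromorphicOrderAt_eval hPne]
  rw [hord] at hnn ⊢
  have htop : meromorphicOrderAt g z ≠ ⊤ := fun ht => by
    rw [ht] at hgle
    exact absurd hgle (by simp)
  lift meromorphicOrderAt g z to ℤ using htop with e
  have h1 : e ≤ m := by exact_mod_cast hgle
  have h2 : 0 ≤ e - ((polePoly V S).rootMultiplicity z : ℤ) := by exact_mod_cast hnn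
  refine ⟨(e - ((polePoly V S).rootMultiplicity z : ℤ)).toNat, by omega, ?_⟩
  rw [Int.toNat_of_nonneg h2]
  rfl

theorem circleIntegrable_kernel (h : IsFamilyBasis V f)
    (hS : ∀ z, z ∈ S ↔ z ∈ singularPoints V) {z : ℂ} {r : ℝ} (hr : 0 < r)
    (hsep : ∀ w ∈ S, w ≠ z → r < dist w z) {k : ℂ → ℂ} (hk : IsPunctured k z r) {g : ℂ → ℂ}
    (hg : g ∈ conjugateSpace V) :
    CircleIntegrable (fun x => k x * (g x * ((polePoly V S).eval x)⁻¹)) z r :=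
  (hk.mul (isPunctured_of_mem_conjugateSpace h hS hsep hg)).circleIntegrable hr

/-- The pairing of the regularized conjugate space with a kernel `k` by integration. -/
noncomputable def pairing (h : IsFamilyBasis V f) (hS : ∀ z, z ∈ S ↔ z ∈ singularPoints V) {z : ℂ}
    {r : ℝ} (hr : 0 < r) (hsep : ∀ w ∈ S, w ≠ z → r < dist w z) {k : ℂ → ℂ}
    (hk : IsPunctured k z r) : conjugateSpace V →ₗ[ℂ] ℂ where
  toFun g := ∮ x in C(z, r), k x * ((g : ℂ → ℂ) x * ((polePoly V S).eval x)⁻¹)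
  map_add' g g' := by
    rw [← circleIntegral.integral_add (circleIntegrable_kernel h hS hr hsep hk g.2)
      (circleIntegrable_kernel h hS hr hsep hk g'.2)]
    congr 1
    funext x
    simp
    ring
  map_smul' c g := by
    rw [RingHom.id_apply, smul_eq_mul, ← circleIntegral.integral_const_mul]
    congr 1
    funext x
    simp
    ring

theorem isPunctured_exp (u z : ℂ) (r : ℝ) : IsPunctured (fun x => Complex.exp (u * x)) z r :=
  IsPunctured.of_entire (by rw [mem_entire]; fun_prop)

/-- Rank and nullity at one singular point. The conjugate space, of dimension `N`, embeds in the
product of the part of the dual space with exponent `z` and `ℂ^(N - M_z)`. -/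
theorem poleOrder_le_multiplicity (h : IsFamilyBasis V f)
    (hS : ∀ z, z ∈ S ↔ z ∈ singularPoints V) [FiniteDimensional ℂ (dualSpace V)] {z : ℂ}
    (hz : z ∈ S) : poleOrder V z ≤ multiplicity (dualSpace V) z := by
  obtain ⟨r, hr, hsep⟩ := exists_radius S z
  set U := dualSpace V with hU
  set K := (U.comap (expPoly z)).map (expPoly z) with hK
  have hKfin : Module.finrank ℂ K = multiplicity U z :=
    (LinearEquiv.finrank_eq (Submodule.equivMapOfInjective _ (expPoly_injective z) _)).symm
  have hKU : K ≤ U := by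
    rintro _ ⟨q, hq, rfl⟩
    exact hq
  have : FiniteDimensional ℂ K := Submodule.finiteDimensional_of_le hKU
  let I : conjugateSpace V →ₗ[ℂ] K := LinearMap.codRestrict K
    (LinearMap.pi fun u => pairing h hS hr hsep (isPunctured_exp u z r)) fun g => by
      obtain ⟨q, hq⟩ := (isPunctured_of_mem_conjugateSpace h hS hsep g.2).transform_mem_range hr
      refine ⟨q, ?_, hq.symm⟩
      rw [SetLike.mem_coe, Submodule.mem_comap, ← hq]
      refine Submodule.subset_span ⟨z, (hS z).1 hz, _,
        (mem_regConjugateSpace_iff hS).2 ⟨g, g.2, rfl⟩, r, hr, fun w hw => hsep w ((hS w).2 hw), rfl⟩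
  -- These functionals give `2πi` times the Taylor coefficients of orders `0, …, N - 1 - M_z` on
  -- elements with zero transform. A nonzero such element has its order in this range, so some
  -- functional detects it.
  let J : conjugateSpace V →ₗ[ℂ] (Fin (m + 1 - poleOrder V z) → ℂ) := LinearMap.pi fun n =>
    pairing h hS hr hsep (IsPunctured.sub_zpow (z := z) (r := r) (-((n : ℕ) : ℤ) - 1))
  have hinj : Function.Injective (I.prod J) := by
    refine (injective_iff_map_eq_zero _).2 fun g hg => ?_
    by_contra hg0
    have hI : I g = 0 := congrArg Prod.fst hg
    have hJ : J g = 0 := congrArg Prod.snd hg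
    obtain ⟨n, hn, hord⟩ := order_of_transform_eq_zero h hS hz hr hsep g.2
      (fun h0 => hg0 (Subtype.ext h0)) (congrArg Subtype.val hI)
    exact (isPunctured_of_mem_conjugateSpace h hS hsep g.2).circleIntegral_ne_zero hr hord
      (congrFun hJ ⟨n, hn⟩)
  have hle := LinearMap.finrank_le_finrank_of_injective hinj
  rw [h.finrank_conjugateSpace, Module.finrank_prod, hKfin, Module.finrank_fin_fun] at hle
  -- Needed because `m + 1 - poleOrder V z` is a truncated subtraction.
  have := h.poleOrder_le z
  omega

end Transform

/-! ### The operator annihilating the dual space -/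

theorem monicOp_exp {N : ℕ} (f : Fin N → ℂ → ℂ) (u x : ℂ) :
    monicOp f (fun y => Complex.exp (u * y)) x =
      ∑ k : Fin (N + 1), opCoeff f k x * u ^ (k : ℕ) * Complex.exp (u * x) := by
  refine Finset.sum_congr rfl fun k _ => ?_
  have h1 : (fun y => Complex.exp (u * y)) = expPoly u 1 := by
    funext y
    simp [expPoly]
  have h2 : ∀ n : ℕ, (twistedDeriv u)^[n] 1 = C (u ^ n) := fun n => by
    induction n with
    | zero => simp
    | succ n ih =>
      rw [Function.iterate_succ_apply', ih, twistedDeriv, derivative_C, zero_add, ← C_mul, pow_succ']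
  rw [h1, iteratedDeriv_expPoly, h2]
  simp [expPoly]
  ring

/-- The operator `∑ a_{jk} u^k ∂_u^j`, where `A_k = ∑ a_{jk} x^j`, applied to `w` at `u`. -/
noncomputable def dualOperator {N : ℕ} (A : Fin (N + 1) → ℂ[X]) (M : ℕ) (w : ℂ → ℂ) (u : ℂ) : ℂ :=
  ∑ j : Fin (M + 1), (∑ k : Fin (N + 1), (A k).coeff j * u ^ (k : ℕ)) * iteratedDeriv (j : ℕ) w u

/-- Under the integral `∂_u^j` becomes `x^j`, and `∑ a_{jk} x^j u^k e^{ux} = P·D̄_V e^{ux}`. The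
factor `P` cancels the regularizing denominator, leaving an integrand `g·D̄_V e^{ux}` without
residues. -/
theorem dualOperator_transform {V : Submodule ℂ (ℂ → ℂ)} {m : ℕ} {f : Fin (m + 1) → ℂ → ℂ}
    {S : Finset ℂ} (h : IsFamilyBasis V f) (hS : ∀ z, z ∈ S ↔ z ∈ singularPoints V)
    {A : Fin (m + 2) → ℂ[X]} {M : ℕ} (hdeg : ∀ k, (A k).natDegree ≤ M)
    (hA : ∀ k x, x ∉ S → (polePoly V S).eval x * opCoeff f k x = (A k).eval x) {z : ℂ} {r : ℝ}
    (hr : 0 < r) (hsep : ∀ w ∈ S, w ≠ z → r < dist w z) {g : ℂ → ℂ}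
    (hg : g ∈ conjugateSpace V) (u : ℂ) :
    dualOperator A M (fun u => ∮ x in C(z, r), Complex.exp (u * x) *
      (g x * ((polePoly V S).eval x)⁻¹)) u = 0 := by
  have hp := isPunctured_of_mem_conjugateSpace h hS hsep hg
  have hsph : ∀ x ∈ Metric.sphere z r, x ∉ S := fun x hx hxS => by
    by_cases hxz : x = z
    · rw [hxz, Metric.mem_sphere, dist_self] at hx
      exact hr.ne hx
    · exact (hsep x hxS hxz).ne' hx
  rw [dualOperator]
  simp only [iteratedDeriv_transform hr (hp.continuousOn_sphere hr)]
  have hint : ∀ (c : ℂ) (j : ℕ), CircleIntegrable (fun x => c * (Complex.exp (u * x) *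
      (x ^ j * (g x * ((polePoly V S).eval x)⁻¹)))) z r := fun c j =>
    (((isPunctured_exp u z r).mul ((IsPunctured.of_entire (f := fun x => x ^ j)
      (by rw [mem_entire]; fun_prop)).mul hp)).circleIntegrable hr).const_smul (a := c)
  simp only [← circleIntegral.integral_const_mul]
  rw [← circleIntegral.integral_fun_sum (f := fun (j : Fin (M + 1)) x =>
    (∑ k : Fin (m + 2), (A k).coeff j * u ^ (k : ℕ)) * (Complex.exp (u * x) *
      (x ^ (j : ℕ) * (g x * ((polePoly V S).eval x)⁻¹)))) fun j _ => hint _ j]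
  rw [← circleIntegral_mul_monicOp h hg (y := fun y => Complex.exp (u * y))
    (by rw [mem_entire]; fun_prop) hr.le fun x hx => fun hx' => hsph x hx ((hS x).2 hx')]
  refine circleIntegral.integral_congr hr.le fun x hx => ?_
  have hP := eval_polePoly_ne_zero (V := V) (hsph x hx)
  have hcoef : ∀ k, opCoeff f k x = ((polePoly V S).eval x)⁻¹ *
      ∑ j : Fin (M + 1), (A k).coeff j * x ^ (j : ℕ) := fun k => by
    have h1 : (A k).eval x = ∑ j : Fin (M + 1), (A k).coeff j * x ^ (j : ℕ) := by
      rw [eval_eq_sum_range' (Nat.lt_succ_of_le (hdeg k)), Finset.sum_range]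
    rw [← h1, ← hA k x (hsph x hx)]
    field_simp
  simp only [monicOp_exp, hcoef, Finset.sum_mul, Finset.mul_sum]
  rw [Finset.sum_comm]
  exact Finset.sum_congr rfl fun k _ => Finset.sum_congr rfl fun j _ => by ring

theorem dualOperator_add {N : ℕ} (A : Fin (N + 1) → ℂ[X]) (M : ℕ) {w w' : ℂ → ℂ}
    (hw : w ∈ entire) (hw' : w' ∈ entire) (u : ℂ) :
    dualOperator A M (w + w') u = dualOperator A M w u + dualOperator A M w' u := by
  rw [dualOperator, dualOperator, dualOperator, ← Finset.sum_add_distrib]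
  exact Finset.sum_congr rfl fun j _ => by
    rw [iteratedDeriv_add (entire_contDiffAt hw _ _) (entire_contDiffAt hw' _ _), mul_add]

/-- The entire functions annihilated by the operator `∑ a_{jk} u^k ∂_u^j`. -/
noncomputable def dualKernel {N : ℕ} (A : Fin (N + 1) → ℂ[X]) (M : ℕ) : Submodule ℂ (ℂ → ℂ) where
  carrier := {w | w ∈ entire ∧ ∀ u, dualOperator A M w u = 0}
  add_mem' hw hw' := ⟨entire.add_mem hw.1 hw'.1, fun u => by
    rw [dualOperator_add A M hw.1 hw'.1, hw.2, hw'.2, add_zero]⟩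
  zero_mem' := ⟨entire.zero_mem, fun u => by
    refine Finset.sum_eq_zero fun j _ => ?_
    rw [show (0 : ℂ → ℂ) = fun _ => (0 : ℂ) from rfl, iteratedDeriv_const]
    simp⟩
  smul_mem' c w hw := ⟨entire.smul_mem c hw.1, fun u => by
    rw [← mul_zero c, ← hw.2 u, dualOperator, dualOperator, Finset.mul_sum]
    refine Finset.sum_congr rfl fun j _ => ?_
    rw [iteratedDeriv_const_smul_field]
    simp
    ring⟩

theorem dualSpace_le_dualKernel {V : Submodule ℂ (ℂ → ℂ)} {m : ℕ} {f : Fin (m + 1) → ℂ → ℂ}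
    {S : Finset ℂ} (h : IsFamilyBasis V f) (hS : ∀ z, z ∈ S ↔ z ∈ singularPoints V)
    {A : Fin (m + 2) → ℂ[X]} {M : ℕ} (hdeg : ∀ k, (A k).natDegree ≤ M)
    (hA : ∀ k x, x ∉ S → (polePoly V S).eval x * opCoeff f k x = (A k).eval x) :
    dualSpace V ≤ dualKernel A M := by
  refine Submodule.span_le.2 ?_
  rintro _ ⟨z, hz, g, hg, r, hr, hsep, rfl⟩
  obtain ⟨g', hg', rfl⟩ := (mem_regConjugateSpace_iff hS).1 hg
  have hsep' : ∀ w ∈ S, w ≠ z → r < dist w z := fun w hw => hsep w ((hS w).1 hw)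
  refine ⟨?_, dualOperator_transform h hS hdeg hA hr hsep' hg'⟩
  obtain ⟨q, hq⟩ := (isPunctured_of_mem_conjugateSpace h hS hsep' hg').transform_mem_range hr
  rw [hq]
  exact expPoly_mem_entire z q

/-- A space annihilated by an operator of order `M` has dimension at most `M`. -/
theorem finrank_le_of_le_dualKernel {U : Submodule ℂ (ℂ → ℂ)} [FiniteDimensional ℂ U] {N : ℕ}
    {A : Fin (N + 1) → ℂ[X]} {M : ℕ} (hU : U ≤ dualKernel A M)
    {u₀ : ℂ} (hne : ∀ᶠ u in 𝓝[≠] u₀, ∑ k : Fin (N + 1), (A k).coeff M * u ^ (k : ℕ) ≠ 0) :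
    Module.finrank ℂ U ≤ M := by
  by_contra hlt
  have hbas := isFamilyBasis_basisOf (V := U) fun w hw => (hU hw).1
  set g : Fin (M + 1) → ℂ → ℂ := fun a => basisOf U (Fin.castLE (by omega) a) with hg
  have hgi : LinearIndependent ℂ g :=
    hbas.linearIndependent.comp _ (Fin.castLE_injective (by omega))
  have hge : ∀ a, g a ∈ entire := fun a => hbas.mem_entire _
  -- At a point where neither the leading coefficient nor the Wronskian of `M + 1` independent
  -- elements vanishes, the `M + 1` coefficients of the operator are killed by an invertible matrix,
  -- a contradiction.
  obtain ⟨u, hu, hW⟩ := (hne.and (eventually_ne_zero_of_entire (wronskian_mem_entire hge)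
    (exists_wronskian_ne_zero hge hgi) u₀)).exists
  have h0 := eq_zero_of_sum_mul_iteratedDeriv hW
    (c := fun j : Fin (M + 1) => ∑ k : Fin (N + 1), (A k).coeff j * u ^ (k : ℕ))
    fun a => (hU (hbas.mem (Fin.castLE (by omega) a))).2 u
  exact hu (congrFun h0 (Fin.last M))

/-! ### The Baker–Akhiezer functions -/

/-- The conjugate space involves `N - 1` functions, so the dimension is written as `m + 1`. It is
positive because some generator has a polynomial factor of positive degree. -/
theorem IsQuasiPolynomialSpace.exists_homogeneousBasis_succ {V : Submodule ℂ (ℂ → ℂ)}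
    (hV : IsQuasiPolynomialSpace V) :
    ∃ (m : ℕ) (l : Fin (m + 1) → ℂ) (p : Fin (m + 1) → ℂ[X]), IsHomogeneousBasis V l p := by
  obtain ⟨N, l, p, h⟩ := hV.exists_homogeneousBasis
  rcases N with _ | m
  · exfalso
    obtain ⟨n, l', N, p', hn, -, hN, hpos, -, rfl⟩ := hV
    have hmem : expPoly (l' ⟨0, hn⟩) (p' ⟨0, hn⟩ ⟨0, hN _⟩) ∈
        Submodule.span ℂ {g | ∃ i j, g = expPoly (l' i) (p' i j)} :=
      Submodule.subset_span ⟨_, _, rfl⟩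
    obtain ⟨c, hc⟩ := h.mem_iff.1 hmem
    rw [Finset.univ_eq_empty, Finset.sum_empty] at hc
    have h0 := expPoly_injective _ ((map_zero _).trans hc)
    have := hpos ⟨0, hn⟩ ⟨0, hN _⟩
    rw [← h0] at this
    simp at this
  · exact ⟨m, l, p, h⟩

theorem IsHomogeneousBasis.prod_sub_ne_zero {N : ℕ} {V : Submodule ℂ (ℂ → ℂ)} {l : Fin N → ℂ}
    {p : Fin N → ℂ[X]} (h : IsHomogeneousBasis V l p) {x : ℂ} (hx : multiplicity V x = 0) :
    ∏ a, (x - l a) ≠ 0 := by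
  classical
  rw [Finset.prod_ne_zero_iff]
  intro a _ hxa
  have h1 := h.card_le_multiplicity x
  rw [hx, Nat.le_zero, Finset.card_eq_zero] at h1
  have : a ∈ (∅ : Finset (Fin N)) := by
    rw [← h1, Finset.mem_filter]
    exact ⟨Finset.mem_univ a, (sub_eq_zero.1 hxa).symm⟩
  simp at this

theorem IsHomogeneousBasis.bakerAkhiezer_eq {N : ℕ} {V : Submodule ℂ (ℂ → ℂ)} {l : Fin N → ℂ}
    {p : Fin N → ℂ[X]} (h : IsHomogeneousBasis V l p) (x ξ : ℂ) :
    bakerAkhiezer (subspaceOf V) x ξ = (∏ᶠ m : ℂ, (ξ - m) ^ multiplicity V m)⁻¹ *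
      ∑ k : Fin (N + 1), opCoeff (fun a => expPoly (l a) (p a)) k x * ξ ^ (k : ℕ) *
        Complex.exp (ξ * x) := by
  have : (fun y => Complex.exp (y * ξ)) = fun y => Complex.exp (ξ * y) :=
    funext fun y => by rw [mul_comm]
  rw [bakerAkhiezer, h.quasiPolySpaceOf_subspaceOf, h.isFamilyBasis.monicOperator_eq, this,
    monicOp_exp]

/-- The monic operator of a space `U` annihilated by an operator of order `dim U`. -/
theorem IsFamilyBasis.opCoeff_eq_of_le_dualKernel {M N : ℕ} {U : Submodule ℂ (ℂ → ℂ)}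
    {f : Fin M → ℂ → ℂ} (h : IsFamilyBasis U f) {A : Fin (N + 1) → ℂ[X]} (hU : U ≤ dualKernel A M)
    {x : ℂ} (hx : x ∉ singularPoints U)
    (hne : ∑ k : Fin (N + 1), (A k).coeff M * x ^ (k : ℕ) ≠ 0) (j : Fin (M + 1)) :
    opCoeff f j x = (∑ k : Fin (N + 1), (A k).coeff j * x ^ (k : ℕ)) /
      ∑ k : Fin (N + 1), (A k).coeff M * x ^ (k : ℕ) := by
  refine eq_opCoeff (h.notMem_singularPoints_iff.1 hx) (c := fun j : Fin (M + 1) =>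
    (∑ k : Fin (N + 1), (A k).coeff j * x ^ (k : ℕ)) /
      ∑ k : Fin (N + 1), (A k).coeff M * x ^ (k : ℕ)) ?_ (fun a => ?_) j
  · simp only [Fin.val_last]
    exact div_self hne
  · have h0 := (hU (h.mem a)).2 x
    rw [dualOperator] at h0
    simp only [div_mul_eq_mul_div, ← Finset.sum_div]
    rw [h0, zero_div]

theorem isBispectralDual_of_dualSpace {V U : Submodule ℂ (ℂ → ℂ)} (hV : IsQuasiPolynomialSpace V)
    (hU : IsQuasiPolynomialSpace U) (hVU : U = dualSpace V) :
    IsBispectralDual (subspaceOf V) (subspaceOf U) := by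
  obtain ⟨m, l, p, h⟩ := hV.exists_homogeneousBasis_succ
  obtain ⟨M, l', p', h'⟩ := hU.exists_homogeneousBasis
  have hUfin := h'.finiteDimensional
  have hf := h.isFamilyBasis
  have hf' := h'.isFamilyBasis
  obtain ⟨S, hS⟩ : ∃ S : Finset ℂ, ∀ z, z ∈ S ↔ z ∈ singularPoints V :=
    ⟨h.finite_singularPoints.toFinset, fun z => by simp⟩
  obtain ⟨A, hdeg, htop, hA⟩ := h.exists_polynomial hS
  -- The leading coefficient of the exchanged operator is the characteristic polynomial `Q` of `V`.
  have hQ : ∀ x, ∑ k : Fin (m + 2), (A k).coeff (polePoly V S).natDegree * x ^ (k : ℕ) =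
      ∏ a, (x - l a) := fun x => by
    simp only [htop]
    have h1 : (∏ a, (X - C (l a))).natDegree < m + 2 := by
      rw [natDegree_prod_of_monic _ _ fun a _ => monic_X_sub_C _]
      simp
    have h2 := eval_eq_sum_range' h1 x
    rw [Finset.sum_range] at h2
    rw [← h2, eval_prod]
    simp
  have hker := dualSpace_le_dualKernel hf hS hdeg hA
  have hle : Module.finrank ℂ U ≤ (polePoly V S).natDegree := by
    refine finrank_le_of_le_dualKernel (hVU.le.trans hker) (u₀ := 0) ?_
    simp only [hQ]
    have hne : (∏ a, (X - C (l a))) ≠ 0 := (monic_prod_of_monic _ _ fun a _ => monic_X_sub_C _).ne_zero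
    filter_upwards [nhdsNE_le_cofinite 0 (eventually_eval_ne_zero hne)] with x hx
    have hx' : (∏ a, (X - C (l a))).eval x ≠ 0 := hx
    rw [eval_prod] at hx'
    simpa using hx'
  have hmul : ∀ z ∈ S, poleOrder V z ≤ multiplicity U z := fun z hz => by
    subst hVU
    exact poleOrder_le_multiplicity hf hS hz
  rw [natDegree_polePoly] at hle
  -- The upper bound `dim U ≤ ∑ M_z` meets the lower bounds `M_z` on the multiplicities, so the
  -- exponents of `U` are accounted for exactly.
  obtain ⟨hm1, hm2⟩ := multiplicity_eq_of_le hmul hle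
  have hPU : ∀ ξ, ∏ᶠ z : ℂ, (ξ - z) ^ multiplicity U z = (polePoly V S).eval ξ := fun ξ => by
    rw [finprod_multiplicity_eq hm1 hm2, eval_polePoly]
  have hM : (polePoly V S).natDegree = M := by
    rw [natDegree_polePoly, ← h'.finrank_eq]
    exact le_antisymm ((Finset.sum_le_sum hmul).trans (sum_multiplicity_le U S)) hle
  rw [hM] at hdeg hker
  simp only [hM] at hQ
  intro x ξ hY hW
  rw [bakerAkhiezerDomain, h'.quasiPolySpaceOf_subspaceOf] at hY
  rw [bakerAkhiezerDomain, h.quasiPolySpaceOf_subspaceOf] at hW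
  have hQx := h.prod_sub_ne_zero (x := x) hW.2
  have hξ : ξ ∉ S := fun h => hW.1 ((hS ξ).1 h)
  have hPξ := eval_polePoly_ne_zero (V := V) hξ
  rw [h'.bakerAkhiezer_eq, h.bakerAkhiezer_eq, hPU, h.finprod_multiplicity]
  have h1 : ∀ j, opCoeff (fun a => expPoly (l' a) (p' a)) j x = (∏ a, (x - l a))⁻¹ *
      ∑ k : Fin (m + 2), (A k).coeff j * x ^ (k : ℕ) := fun j => by
    rw [hf'.opCoeff_eq_of_le_dualKernel (hVU.le.trans hker) hY.1 (by rw [hQ]; exact hQx), hQ,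
      div_eq_inv_mul]
  have h2 : ∀ k, opCoeff (fun a => expPoly (l a) (p a)) k ξ = ((polePoly V S).eval ξ)⁻¹ *
      ∑ j : Fin (M + 1), (A k).coeff j * ξ ^ (j : ℕ) := fun k => by
    have e : (A k).eval ξ = ∑ j : Fin (M + 1), (A k).coeff j * ξ ^ (j : ℕ) := by
      rw [eval_eq_sum_range' (Nat.lt_succ_of_le (hdeg k)), Finset.sum_range]
    rw [← e, ← hA k ξ hξ]
    field_simp
  -- Both sides are now `P(ξ)⁻¹ Q(x)⁻¹ ∑ a_{jk} ξ^j x^k e^{xξ}`, summed in the two possible orders.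
  simp only [h1, h2, Finset.mul_sum, Finset.sum_mul]
  rw [Finset.sum_comm]
  refine Finset.sum_congr rfl fun k _ => Finset.sum_congr rfl fun j _ => ?_
  rw [mul_comm ξ x]
  ring

end Bispectral

theorem mainTheorem8 (V U : Submodule ℂ (ℂ → ℂ))
    (hV : Bispectral.IsQuasiPolynomialSpace V) (hU : Bispectral.IsQuasiPolynomialSpace U)
    (hVU : U = Bispectral.dualSpace V) :
    Bispectral.subspaceOf V ∈ Bispectral.Gr ∧ Bispectral.subspaceOf U ∈ Bispectral.Gr ∧
      Bispectral.IsBispectralDual (Bispectral.subspaceOf V) (Bispectral.subspaceOf U) :=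
  ⟨hV.subspaceOf_mem_Gr, hU.subspaceOf_mem_Gr, Bispectral.isBispectralDual_of_dualSpace hV hU hVU⟩
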